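/- Let $\beta\ge\beta_0>1/2$, $L>0$, $\alpha\in(0,1)$. Let $\phi_1,\phi_2,\dots$ be uniformly bounded real functions on $[0,1]$ (for instance a uniformly bounded basis of $L_2[0,1]$) and, for a coefficient sequence $\theta=(\theta_1,\theta_2,\dots)$, write $f_\theta=\sum_{j\ge1}\theta_j\phi_j$; a vector $\theta\in\mathbb R^k$ is identified with $(\theta_1,\dots,\theta_k,0,0,\dots)$. For every $n$ let $x_1,\dots,x_n\in[0,1]$ be fixed design points (which may depend on $n$) and let $P_\theta^{(n)}$ be the law of $\mathbf Y=(Y_1,\dots,Y_n)$, $Y_i=f_\theta(x_i)+Z_i$, with $Z_1,\dots,Z_n$ i.i.d. standard normal. Let $d_n(\theta,\theta')^2=\frac1n\sum_{i=1}^n(f_\theta(x_i)-f_{\theta'}(x_i))^2$ and $\Phi_k=(\phi_j(x_i))_{1\le i\le n,\,1\le j\le k}\in\mathbb R^{n\times k}$. Suppose that there are integers $K_n$ such that, for all sufficiently large $n$, $$K_n>n^{\frac{\beta_0}{(1+2\beta_0)(\beta_0-1/2)}}\qquad\text{and}\qquad \Phi_k^T\Phi_k=nI_k\ \text{ for all }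 k\le K_n .$$ Let $g$ be a fixed (not depending on $n$) nondegenerate normal distribution, or a fixed Laplace distribution with location $\mu\in\mathbb R$ and scale $b>0$. In the model $\Theta(k)=\mathbb R^k$ use the prior $\pi_{|k}$ under which $\theta_1,\dots,\theta_k$ are i.i.d. with law $g$. Let $\pi_{|k}(\cdot\mid\mathbf Y)$ be the corresponding posterior distribution, $\hat\theta_k$ its mean, and $r_\alpha(k)=\inf\{r:\ \pi_{|k}(d_n(\theta,\hat\theta_k)\le r\mid\mathbf Y)\ge1-\alpha\}$. Let $\hat k_n$ be any maximizer over $k\in\{1,\dots,\bar K_n\}$ of the marginal likelihood $k\mapsto\int_{\mathbb R^k}p_\theta^{(n)}(\mathbf Y)\,\pi_{|k}(d\theta)$, where $p_\theta^{(n)}$ is the density of $P_\theta^{(n)}$ and $\bar K_n$ are integers with $1\le\bar K_n\le K_n$ for all sufficiently large $n$. Let $\mathcal H_s^\beta(L)$ be the class of self-similar sequences $\theta$, i.e. those with $L^{-1}i^{-\beta-1/2}\le|\theta_i|\le L\,i^{-\beta-1/2}$ for all $i\ge1$. Then for every real sequence $m_n\to0$ the empirical Bayes credible ball centred at the posterior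 mean and inflated by $m_n\sqrt{\log n}$ has frequentist coverage tending to zero, uniformly over this class: $$\limsup_{n\to\infty}\ \sup_{\theta_0\in\mathcal H_s^\beta(L)}P_{\theta_0}^{(n)}\Big(d_n(\theta_0,\hat\theta_{\hat k_n})\le m_n\sqrt{\log n}\;r_\alpha(\hat k_n)\Big)=0 .$$ -/

import Mathlib

open MeasureTheory ProbabilityTheory Filter Topology
open scoped ENNReal

noncomputable section

namespace SieveRegression

/-- The Laplace distribution with location `μ` and scale `b`. -/
def laplaceReal (μ b : ℝ) : Measure ℝ :=
  volume.withDensity fun t => ENNReal.ofReal (Real.exp (-|t - μ| / b) / (2 * b))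

/-- The regression function `f_θ = ∑ θ_j φ_j`. The basis functions and the coefficients are
numbered from `0` here: `φ j`, `θ j` stand for the usual `φ_{j+1}`, `θ_{j+1}`. -/
def regFun (φ : ℕ → unitInterval → ℝ) (θ : ℕ → ℝ) (t : unitInterval) : ℝ :=
  ∑' j, θ j * φ j t

/-- The inclusion of `Θ(k) = ℝ^k` in the space of coefficient sequences, by adding zeros. -/
def padZero {k : ℕ} (θ : Fin k → ℝ) (j : ℕ) : ℝ :=
  if h : j < k then θ ⟨j, h⟩ else 0

/-- The self-similar hyper-rectangle
`L⁻¹ i^(-β-1/2) ≤ |θ_i| ≤ L i^(-β-1/2)`, `i = 1, 2, …` (with `i = j + 1`). -/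
def selfSimilar (β L : ℝ) : Set (ℕ → ℝ) :=
  {θ | ∀ j : ℕ, L⁻¹ * ((j : ℝ) + 1) ^ (-β - 1 / 2) ≤ |θ j| ∧
    |θ j| ≤ L * ((j : ℝ) + 1) ^ (-β - 1 / 2)}

/-- The `n × k` design matrix `Φ_k = (φ_1, …, φ_k)` at the design points `x_1, …, x_n`. -/
def designMatrix (φ : ℕ → unitInterval → ℝ) {n : ℕ} (x : Fin n → unitInterval) (k : ℕ) :
    Matrix (Fin n) (Fin k) ℝ :=
  Matrix.of fun i j => φ j (x i)

/-- The empirical `L²` semi-metric `d_n(θ, θ')`. -/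
def empDist (φ : ℕ → unitInterval → ℝ) {n : ℕ} (x : Fin n → unitInterval)
    (θ θ' : ℕ → ℝ) : ℝ :=
  Real.sqrt ((n : ℝ)⁻¹ * ∑ i, (regFun φ θ (x i) - regFun φ θ' (x i)) ^ 2)

/-- The law of `Y = (Y_1, …, Y_n)`, `Y_i = f_θ(x_i) + Z_i` with i.i.d. standard normal `Z_i`. -/
def dataLaw (φ : ℕ → unitInterval → ℝ) {n : ℕ} (x : Fin n → unitInterval) (θ : ℕ → ℝ) :
    Measure (Fin n → ℝ) :=
  Measure.pi fun i => gaussianReal (regFun φ θ (x i)) 1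

/-- The likelihood of `θ` at the observation `Y`: the Lebesgue density of `dataLaw φ x θ`. -/
def likelihood (φ : ℕ → unitInterval → ℝ) {n : ℕ} (x : Fin n → unitInterval)
    (Y : Fin n → ℝ) (θ : ℕ → ℝ) : ℝ≥0∞ :=
  ∏ i, gaussianPDF (regFun φ θ (x i)) 1 (Y i)

/-- The prior on `Θ(k) = ℝ^k`: i.i.d. coordinates with law `g`. -/
def prior (g : Measure ℝ) (k : ℕ) : Measure (Fin k → ℝ) :=
  Measure.pi fun _ => g

/-- The marginal likelihood of the model `Θ(k)`. -/
def marginalLikelihood (φ : ℕ → unitInterval → ℝ) (g : Measure ℝ) {n : ℕ}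
    (x : Fin n → unitInterval) (Y : Fin n → ℝ) (k : ℕ) : ℝ≥0∞ :=
  ∫⁻ θ, likelihood φ x Y (padZero θ) ∂(prior g k)

/-- The posterior distribution on `Θ(k)` given `k` and `Y` (Bayes' formula). -/
def posterior (φ : ℕ → unitInterval → ℝ) (g : Measure ℝ) {n : ℕ}
    (x : Fin n → unitInterval) (Y : Fin n → ℝ) (k : ℕ) : Measure (Fin k → ℝ) :=
  (marginalLikelihood φ g x Y k)⁻¹ •
    (prior g k).withDensity fun θ => likelihood φ x Y (padZero θ)

/-- The posterior mean in the model `Θ(k)`, as an element of `Θ(k)`. -/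
def posteriorMean (φ : ℕ → unitInterval → ℝ) (g : Measure ℝ) {n : ℕ}
    (x : Fin n → unitInterval) (Y : Fin n → ℝ) (k : ℕ) : Fin k → ℝ :=
  fun j => ∫ θ, θ j ∂(posterior φ g x Y k)

/-- The radius `r_α(k)` of the credible ball around the posterior mean in the model `Θ(k)`: the
smallest `r` for which the ball has posterior mass at least `1 - α`. -/
def credibleRadius (φ : ℕ → unitInterval → ℝ) (g : Measure ℝ) {n : ℕ}
    (x : Fin n → unitInterval) (α : ℝ) (Y : Fin n → ℝ) (k : ℕ) : ℝ :=
  sInf {r : ℝ | ENNReal.ofReal (1 - α) ≤ posterior φ g x Y k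
    {θ | empDist φ x (padZero θ) (padZero (posteriorMean φ g x Y k)) ≤ r}}

/-- The credible ball of the model `Θ(k)` with its radius multiplied by `c`. -/
def credibleSet (φ : ℕ → unitInterval → ℝ) (g : Measure ℝ) {n : ℕ}
    (x : Fin n → unitInterval) (α c : ℝ) (Y : Fin n → ℝ) (k : ℕ) : Set (ℕ → ℝ) :=
  {θ | empDist φ x θ (padZero (posteriorMean φ g x Y k)) ≤ c * credibleRadius φ g x α Y k}

/-- `khat` is a maximum marginal likelihood estimator of `k` over `{1, …, Kbar}`. -/
def IsMMLE (φ : ℕ → unitInterval → ℝ) (g : Measure ℝ) {n : ℕ}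
    (x : Fin n → unitInterval) (Kbar : ℕ) (khat : (Fin n → ℝ) → ℕ) : Prop :=
  ∀ Y, khat Y ∈ Finset.Icc 1 Kbar ∧
    ∀ k ∈ Finset.Icc 1 Kbar,
      marginalLikelihood φ g x Y k ≤ marginalLikelihood φ g x Y (khat Y)

/-- Coordinate priors: a nondegenerate normal or a Laplace distribution. -/
def IsNormalOrLaplace (g : Measure ℝ) : Prop :=
  (∃ (μ : ℝ) (v : NNReal), v ≠ 0 ∧ g = gaussianReal μ v) ∨
    ∃ μ b : ℝ, 0 < b ∧ g = laplaceReal μ b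

end SieveRegression

end

namespace SieveRegression

/-! ### Products of measures -/

/-! The selected model is either too small, so that its bias exceeds the inflated radius, or so
large that only an unlikely noise configuration could have selected it. The border is a critical
dimension `κ` of order `(n / log n) ^ (1 / (1 + 2 * β))` (`cutoff`).

The orthogonal design turns each model into a Gaussian sequence model with noise variance `1 / n`:
likelihood, marginal likelihood and posterior factor over coordinates
(`IsOrthDesign.likelihood_padZero`, `IsOrthDesign.posterior_eq`). Of the prior only a bounded
log-concave density is needed.

If `k ≤ 2 * κ`: log-concavity makes every posterior coordinate variance at most `1 / n`
(`exists_center`), so the squared credible radius is at most `k / (n * α)`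
(`IsOrthDesign.credibleRadius_le`), which is `O(κ / n)`. Self-similarity forces a squared bias of
order at least `κ ^ (-2 * β)`, hence of order `κ * log n / n` (`selfSimilar.le_sum_sq`). Inflation
of the squared radius by `m_n ^ 2 * log n` with `m_n → 0` cannot make up for it.

If `k > 2 * κ`: an additional coordinate multiplies the marginal likelihood by at most a constant
times `n ^ (-1 / 2) * exp (n * y ^ 2 / 2)` (`coordMass_le`). Beyond `κ` the signal is too weak to
pay for this, so the noise coefficients would have to be large on average
(`IsOrthDesign.le_sum_noise`). A weighted sum of fourth powers, not depending on `k`, detects this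
for all `k` at once; its expectation is `O(log n)` against a threshold of order `(log n) ^ 2`, so
Markov's inequality gives a probability `O(1 / log n)`, uniformly in the true parameter
(`IsOrthDesign.dataLaw_noise_le`).

Orthogonality is available only up to `K_n`. The remaining series is bounded uniformly by a multiple
of `K_n ^ (-(β - 1 / 2))`, and the lower bound on `K_n` makes its contribution negligible compared
with `κ * log n / n`. -/

theorem lintegral_fin_prod {α : Type*} [MeasurableSpace α] {k : ℕ} {ν : Fin k → Measure α}
    [∀ i, SigmaFinite (ν i)] {f : Fin k → α → ℝ≥0∞} (hf : ∀ i, Measurable (f i)) :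
    ∫⁻ t, ∏ i, f i (t i) ∂(Measure.pi ν) = ∏ i, ∫⁻ t, f i t ∂(ν i) := by
  induction k with
  | zero => simp
  | succ k ih =>
    have hmeas' : Measurable fun z : Fin k → α => ∏ i : Fin k, f i.succ (z i) :=
      Finset.measurable_prod _ fun i _ => (hf i.succ).comp (measurable_pi_apply i)
    have hmeas : Measurable fun z : α × (Fin k → α) => f 0 z.1 * ∏ i : Fin k, f i.succ (z.2 i) :=
      ((hf 0).comp measurable_fst).mul (hmeas'.comp measurable_snd)
    calc
      _ = ∫⁻ z : α × (Fin k → α), f 0 z.1 * ∏ i : Fin k, f i.succ (z.2 i)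
            ∂((ν 0).prod (Measure.pi fun i => ν i.succ)) := by
          refine Eq.trans ?_ ((measurePreserving_piFinSuccAbove ν 0).lintegral_comp hmeas)
          refine lintegral_congr fun t => ?_
          rw [Fin.prod_univ_succ]
          rfl
      _ = (∫⁻ t, f 0 t ∂ν 0) * ∏ i : Fin k, ∫⁻ t, f i.succ t ∂ν i.succ := by
          rw [← ih fun i => hf i.succ]
          exact lintegral_prod_mul (hf 0).aemeasurable hmeas'.aemeasurable
      _ = ∏ i, ∫⁻ t, f i t ∂(ν i) := by rw [Fin.prod_univ_succ]

theorem pi_withDensity {k : ℕ} {ν : Measure ℝ} [SigmaFinite ν] {f : Fin k → ℝ → ℝ≥0∞}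
    (hf : ∀ i, Measurable (f i)) (c : Fin k → ℝ≥0∞)
    [∀ i, SigmaFinite (c i • ν.withDensity (f i))] :
    Measure.pi (fun i => c i • ν.withDensity (f i)) =
      (∏ i, c i) • (Measure.pi fun _ : Fin k => ν).withDensity fun t => ∏ i, f i (t i) := by
  refine Measure.pi_eq fun s hs => ?_
  rw [Measure.smul_apply, withDensity_apply _ (MeasurableSet.univ_pi hs),
    ← lintegral_indicator (MeasurableSet.univ_pi hs)]
  have h : ∀ t : Fin k → ℝ, (Set.univ.pi s).indicator (fun t => ∏ i, f i (t i)) t =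
      ∏ i, (s i).indicator (f i) (t i) := by
    intro t
    by_cases ht : t ∈ Set.univ.pi s
    · rw [Set.indicator_of_mem ht]
      exact Finset.prod_congr rfl fun i _ => (Set.indicator_of_mem (ht i trivial) _).symm
    · rw [Set.indicator_of_notMem ht]
      obtain ⟨i, hi⟩ : ∃ i, t i ∉ s i := by simpa using ht
      exact (Finset.prod_eq_zero (Finset.mem_univ i) (Set.indicator_of_notMem hi _)).symm
  simp_rw [h]
  rw [lintegral_fin_prod fun i => (hf i).indicator (hs i), smul_eq_mul, ← Finset.prod_mul_distrib]
  refine Finset.prod_congr rfl fun i _ => ?_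
  rw [Measure.smul_apply, withDensity_apply _ (hs i), lintegral_indicator (hs i), smul_eq_mul]

/-! ### Coordinate priors with a log-concave density -/

/-- The measure on the line with Lebesgue density `exp (-ψ)`. -/
noncomputable def expMeasure (ψ : ℝ → ℝ) : Measure ℝ :=
  volume.withDensity fun t => ENNReal.ofReal (Real.exp (-ψ t))

instance (ψ : ℝ → ℝ) : SigmaFinite (expMeasure ψ) := by
  unfold expMeasure; exact SigmaFinite.withDensity_ofReal _

/-- These are the only features of the prior that matter: convexity of `ψ` controls the posterior
variance, the bound `G` controls the marginal likelihood. The normalizing constant is absorbed in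
`ψ`. -/
theorem IsNormalOrLaplace.exists_potential {g : Measure ℝ} (hg : IsNormalOrLaplace g) :
    ∃ (ψ : ℝ → ℝ) (G : ℝ), ConvexOn ℝ Set.univ ψ ∧ (∀ t, Real.exp (-ψ t) ≤ G) ∧
      g = expMeasure ψ := by
  rcases hg with ⟨μ, v, hv, rfl⟩ | ⟨μ, b, hb, rfl⟩
  · have hv' : (0 : ℝ) < v := by positivity
    refine ⟨fun t => (2 * (v : ℝ))⁻¹ * (t - μ) ^ 2 + Real.log (Real.sqrt (2 * Real.pi * v)),
      (Real.sqrt (2 * Real.pi * v))⁻¹, ?_, fun t => ?_, ?_⟩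
    · refine ConvexOn.add_const ?_ _
      have h := ((even_two.convexOn_pow (𝕜 := ℝ)).translate_right (-μ)).smul
        (c := (2 * (v : ℝ))⁻¹) (by positivity)
      simpa [Function.comp_def, sub_eq_neg_add] using h
    · rw [neg_add, Real.exp_add, Real.exp_neg (Real.log _), Real.exp_log (by positivity)]
      refine mul_le_of_le_one_left (by positivity) (Real.exp_le_one_iff.2 ?_)
      simp only [Left.neg_nonpos_iff]; positivity
    · rw [gaussianReal_of_var_ne_zero μ hv, expMeasure]
      congr 1
      ext t
      rw [gaussianPDF, gaussianPDFReal, neg_add, Real.exp_add, Real.exp_neg (Real.log _),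
        Real.exp_log (by positivity), mul_comm]
      congr 3
      field_simp
  · refine ⟨fun t => b⁻¹ * |t - μ| + Real.log (2 * b), (2 * b)⁻¹, ?_, fun t => ?_, ?_⟩
    · refine ConvexOn.add_const ?_ _
      have h := ((convexOn_norm (convex_univ (𝕜 := ℝ) (E := ℝ))).translate_right (-μ)).smul
        (c := b⁻¹) (by positivity)
      simpa [Function.comp_def, sub_eq_neg_add] using h
    · rw [neg_add, Real.exp_add, Real.exp_neg (Real.log _), Real.exp_log (by positivity)]
      refine mul_le_of_le_one_left (by positivity) (Real.exp_le_one_iff.2 ?_)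
      simp only [Left.neg_nonpos_iff]; positivity
    · rw [laplaceReal, expMeasure]
      congr 1
      ext t
      rw [neg_add, Real.exp_add, Real.exp_neg (Real.log _), Real.exp_log (by positivity),
        ← div_eq_mul_inv]
      congr 3
      field_simp

/-- The likelihood factor of one coordinate, in a Gaussian sequence model with noise variance
`1 / r` and observation `y`. -/
noncomputable def tilt (r y t : ℝ) : ℝ≥0∞ :=
  ENNReal.ofReal (Real.exp (r * y * t - r * t ^ 2 / 2))

theorem measurable_tilt (r y : ℝ) : Measurable (tilt r y) := by
  unfold tilt; fun_prop

/-- The marginal likelihood of one coordinate. -/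
noncomputable def coordMass (g : Measure ℝ) (r y : ℝ) : ℝ≥0∞ :=
  ∫⁻ t, tilt r y t ∂g

theorem continuous_of_convexOn_univ {ψ : ℝ → ℝ} (hψ : ConvexOn ℝ Set.univ ψ) : Continuous ψ :=
  continuousOn_univ.1 (hψ.continuousOn isOpen_univ)

theorem lintegral_expMeasure {ψ : ℝ → ℝ} (hψ : Measurable ψ) {f : ℝ → ℝ≥0∞} (hf : Measurable f) :
    ∫⁻ t, f t ∂expMeasure ψ = ∫⁻ t, ENNReal.ofReal (Real.exp (-ψ t)) * f t := by
  rw [expMeasure, lintegral_withDensity_eq_lintegral_mul _ (by fun_prop) hf]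
  rfl

/-- After replacing the prior density by its bound `G`, a Gaussian integral remains. The factor of
order `r ^ (-1 / 2)` is the price of an additional coordinate. -/
theorem coordMass_le {ψ : ℝ → ℝ} (hψ : ConvexOn ℝ Set.univ ψ) {G : ℝ}
    (hG : ∀ t, Real.exp (-ψ t) ≤ G) {r : ℝ} (hr : 0 < r) (y : ℝ) :
    coordMass (expMeasure ψ) r y ≤
      ENNReal.ofReal (G * Real.sqrt (2 * Real.pi / r) * Real.exp (r * y ^ 2 / 2)) := by
  have hψm := (continuous_of_convexOn_univ hψ).measurable
  have hG0 : 0 < G := (Real.exp_pos _).trans_le (hG 0)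
  rw [coordMass, lintegral_expMeasure hψm (measurable_tilt r y)]
  have hvr : ((r⁻¹).toNNReal : ℝ) = r⁻¹ := Real.coe_toNNReal _ (by positivity)
  have hv : (r⁻¹).toNNReal ≠ 0 := (Real.toNNReal_pos.2 (by positivity)).ne'
  calc
    _ ≤ ∫⁻ t, ENNReal.ofReal (G * Real.sqrt (2 * Real.pi / r) * Real.exp (r * y ^ 2 / 2)) *
          gaussianPDF y (r⁻¹).toNNReal t := by
        refine lintegral_mono fun t => ?_
        rw [tilt, gaussianPDF, ← ENNReal.ofReal_mul (by positivity),
          ← ENNReal.ofReal_mul (by positivity)]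
        refine ENNReal.ofReal_le_ofReal ?_
        have h1 : G * Real.sqrt (2 * Real.pi / r) * Real.exp (r * y ^ 2 / 2) *
            gaussianPDFReal y (r⁻¹).toNNReal t = G * Real.exp (r * y * t - r * t ^ 2 / 2) := by
          have h3 : r * y * t - r * t ^ 2 / 2 = r * y ^ 2 / 2 + -(t - y) ^ 2 / (2 * r⁻¹) := by
            field_simp; ring
          have h4 : Real.sqrt (2 * Real.pi / r) ≠ 0 := by positivity
          rw [gaussianPDFReal, hvr, ← div_eq_mul_inv, h3, Real.exp_add]
          field_simp
        rw [h1]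
        gcongr
        exact hG t
    _ = _ := by
        rw [lintegral_const_mul _ (measurable_gaussianPDF _ _),
          lintegral_gaussianPDF_eq_one _ hv, mul_one]

theorem coordMass_ne_zero {ψ : ℝ → ℝ} (hψ : Measurable ψ) (r y : ℝ) :
    coordMass (expMeasure ψ) r y ≠ 0 := by
  rw [coordMass, lintegral_expMeasure hψ (measurable_tilt r y)]
  refine (lintegral_pos_iff_support (by unfold tilt; fun_prop)).2 ?_ |>.ne'
  have : (Function.support fun t => ENNReal.ofReal (Real.exp (-ψ t)) * tilt r y t) = Set.univ := by
    ext t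
    simp [tilt, Real.exp_pos]
  rw [this]; simp

/-- First-order condition at the posterior mode `m`, without differentiability: `-r * (m - y)` is a
subgradient of `ψ` at `m`. The factor `* 0` gives the left side the form of the right side at `s =
0`. -/
theorem exists_minimizer {ψ : ℝ → ℝ} (hψ : ConvexOn ℝ Set.univ ψ) {G : ℝ}
    (hG : ∀ t, Real.exp (-ψ t) ≤ G) {r : ℝ} (hr : 0 < r) (y : ℝ) :
    ∃ m, ∀ s, r * (m - y) * 0 + ψ m ≤ r * (m - y) * s + ψ (m + s) := by
  have hψc := continuous_of_convexOn_univ hψ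
  have hG0 : 0 < G := (Real.exp_pos _).trans_le (hG 0)
  have hlow : ∀ t, -Real.log G ≤ ψ t := fun t => by
    have := (Real.le_log_iff_exp_le hG0).2 (hG t)
    linarith
  obtain ⟨m, hm⟩ : ∃ m, ∀ t, r / 2 * (m - y) ^ 2 + ψ m ≤ r / 2 * (t - y) ^ 2 + ψ t := by
    refine Continuous.exists_forall_le (f := fun t => r / 2 * (t - y) ^ 2 + ψ t) (by fun_prop) ?_
    refine tendsto_atTop_add_right_of_le _ (-Real.log G) ?_ hlow
    refine Tendsto.const_mul_atTop (by positivity) ?_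
    have h1 : Tendsto (fun t : ℝ => ‖t - y‖) (cocompact ℝ) atTop :=
      tendsto_norm_cocompact_atTop.comp (Homeomorph.subRight y).isClosedEmbedding.tendsto_cocompact
    have h2 := (tendsto_pow_atTop (two_ne_zero)).comp h1
    simpa [Function.comp_def] using h2
  refine ⟨m, fun s => ?_⟩
  -- Minimality is tested at `m + l * s`, `ψ` is bounded by convexity on the segment, and the result
  -- is divided by `l`. The quadratic remainder disappears as `l` tends to `0`.
  have key : ∀ l ∈ Set.Ioc (0 : ℝ) 1, ψ m ≤ r * (m - y) * s + ψ (m + s) + l * (r / 2 * s ^ 2) := by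
    rintro l ⟨hl0, hl1⟩
    have h1 := hm (m + l * s)
    have h2 := hψ.2 (Set.mem_univ m) (Set.mem_univ (m + s)) (sub_nonneg.2 hl1) hl0.le (by ring)
    simp only [smul_eq_mul] at h2
    rw [show (1 - l) * m + l * (m + s) = m + l * s by ring] at h2
    have h3 : 0 ≤ l * (r * (m - y) * s + ψ (m + s) + l * (r / 2 * s ^ 2) - ψ m) := by nlinarith
    have := nonneg_of_mul_nonneg_right h3 hl0
    linarith
  have hlim : Tendsto (fun l : ℝ => r * (m - y) * s + ψ (m + s) + l * (r / 2 * s ^ 2)) (𝓝[>] 0)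
      (𝓝 (r * (m - y) * s + ψ (m + s) + 0 * (r / 2 * s ^ 2))) :=
    (Continuous.tendsto (by fun_prop) _).mono_left nhdsWithin_le_nhds
  have := ge_of_tendsto hlim
    (by filter_upwards [Ioc_mem_nhdsGT (zero_lt_one (α := ℝ))] with l hl using key l hl)
  linarith

/-- A correlation inequality: symmetrized over `±s`, the weight `exp (-W)` is nonincreasing in
`|s|`, whereas `s ^ 2 - v` is increasing in `|s|` and has Gaussian mean zero. -/
theorem integral_sq_sub_mul_nonpos {W : ℝ → ℝ} (hW : ConvexOn ℝ Set.univ W) (hmin : ∀ s, W 0 ≤ W s)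
    {v : NNReal} :
    ∫ s, (s ^ 2 - v) * Real.exp (-W s) ∂gaussianReal 0 v ≤ 0 := by
  have hWc := continuous_of_convexOn_univ hW
  set γ := gaussianReal 0 v
  have hmono : ∀ {s s' : ℝ}, 0 ≤ s → s ≤ s' → ∀ e : ℝ, W (e * s) ≤ W (e * s') := by
    intro s s' hs hss' e
    rcases hs.eq_or_lt with rfl | hs0
    · simpa using hmin _
    have hs' : 0 < s' := hs0.trans_le hss'
    have h2 := hW.2 (Set.mem_univ 0) (Set.mem_univ (e * s'))
      (sub_nonneg.2 ((div_le_one hs').2 hss')) (by positivity : 0 ≤ s / s') (by ring)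
    simp only [smul_eq_mul, mul_zero, zero_add] at h2
    rw [show s / s' * (e * s') = e * s by field_simp] at h2
    have h3 := mul_le_mul_of_nonneg_left (hmin (e * s')) (sub_nonneg.2 ((div_le_one hs').2 hss'))
    linarith
  have hsq : Integrable (fun s : ℝ => s ^ 2 - (v : ℝ)) γ :=
    (memLp_id_gaussianReal 2).integrable_sq.sub (integrable_const _)
  have hint : Integrable (fun s : ℝ => (s ^ 2 - (v : ℝ)) * Real.exp (-W s)) γ := by
    refine hsq.mul_bdd (c := Real.exp (-W 0)) (by fun_prop) (ae_of_all _ fun s => ?_)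
    rw [Real.norm_eq_abs, Real.abs_exp]
    exact Real.exp_le_exp.2 (neg_le_neg (hmin s))
  have hmap : γ.map (fun s => -s) = γ := by
    simpa using gaussianReal_map_neg (μ := 0) (v := v)
  have hint' : Integrable (fun s : ℝ => (s ^ 2 - (v : ℝ)) * Real.exp (-W (-s))) γ := by
    have h : Integrable (fun s : ℝ => (s ^ 2 - (v : ℝ)) * Real.exp (-W s)) (γ.map fun s => -s) := by
      rwa [hmap]
    simpa [Function.comp_def] using h.comp_measurable measurable_neg
  have hneg : ∫ s, (s ^ 2 - (v : ℝ)) * Real.exp (-W (-s)) ∂γ =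
      ∫ s, (s ^ 2 - (v : ℝ)) * Real.exp (-W s) ∂γ := by
    conv_rhs => rw [← hmap]
    rw [integral_map (by fun_prop) (by fun_prop)]
    simp
  -- The symmetrized weight at `|s| = √v`, where `s ^ 2 - v` changes sign. Replacing the weight by
  -- this constant can only increase the product, on either side of the sign change.
  set c := Real.exp (-W (Real.sqrt v)) + Real.exp (-W (-Real.sqrt v)) with hc
  have hpt : ∀ s : ℝ, (s ^ 2 - (v : ℝ)) * Real.exp (-W s) + (s ^ 2 - (v : ℝ)) * Real.exp (-W (-s)) ≤
      (s ^ 2 - (v : ℝ)) * c := by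
    intro s
    rw [← mul_add]
    have hs : Real.exp (-W s) + Real.exp (-W (-s)) = Real.exp (-W |s|) + Real.exp (-W (-|s|)) := by
      rcases abs_choice s with h | h <;> rw [h]
      rw [neg_neg, add_comm]
    rw [hs, hc]
    rcases le_total (s ^ 2) v with h | h
    · have h1 : |s| ≤ Real.sqrt v := Real.abs_le_sqrt h
      refine mul_le_mul_of_nonpos_left ?_ (by linarith)
      have h2 := hmono (abs_nonneg s) h1 1
      have h3 := hmono (abs_nonneg s) h1 (-1)
      simp only [one_mul, neg_one_mul] at h2 h3
      gcongr
    · have h1 : Real.sqrt v ≤ |s| := Real.sqrt_le_iff.2 ⟨abs_nonneg s, by simpa using h⟩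
      refine mul_le_mul_of_nonneg_left ?_ (by linarith)
      have h2 := hmono (Real.sqrt_nonneg v) h1 1
      have h3 := hmono (Real.sqrt_nonneg v) h1 (-1)
      simp only [one_mul, neg_one_mul] at h2 h3
      gcongr
  have hzero : ∫ s, (s ^ 2 - (v : ℝ)) ∂γ = 0 := by
    have h := variance_fun_id_gaussianReal (μ := 0) (v := v)
    rw [variance_of_integral_eq_zero (by fun_prop) (by simp)] at h
    have h2 : Integrable (fun s : ℝ => s ^ 2) γ := (memLp_id_gaussianReal 2).integrable_sq
    rw [integral_sub h2 (integrable_const _), h]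
    simp [γ]
  have := integral_mono (hint.add hint') (hsq.mul_const c) hpt
  rw [integral_mul_const, hzero, zero_mul] at this
  simp only [Pi.add_apply] at this
  rw [integral_add hint hint', hneg] at this
  linarith

/-- A log-concave prior cannot increase the variance above that of the likelihood: around its mode
the posterior is `N(0, 1 / r)` reweighted by `exp (-W)`, with `W` convex and minimal at `0`, so
`integral_sq_sub_mul_nonpos` applies. -/
theorem exists_center {ψ : ℝ → ℝ} (hψ : ConvexOn ℝ Set.univ ψ) {G : ℝ}
    (hG : ∀ t, Real.exp (-ψ t) ≤ G) {r : ℝ} (hr : 0 < r) (y : ℝ) :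
    ∃ m, ∫⁻ t, ENNReal.ofReal ((t - m) ^ 2) * tilt r y t ∂expMeasure ψ ≤
      ENNReal.ofReal r⁻¹ * coordMass (expMeasure ψ) r y := by
  obtain ⟨m, hm⟩ := exists_minimizer hψ hG hr y
  have hψc := continuous_of_convexOn_univ hψ
  refine ⟨m, ?_⟩
  set v : NNReal := (r⁻¹).toNNReal
  have hvr : (v : ℝ) = r⁻¹ := Real.coe_toNNReal _ (by positivity)
  have hv : v ≠ 0 := (Real.toNNReal_pos.2 (by positivity)).ne'
  set W : ℝ → ℝ := fun s => r * (m - y) * s + ψ (m + s) with hWdef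
  have hW : ConvexOn ℝ Set.univ W := by
    refine ConvexOn.add ?_ ?_
    · exact (LinearMap.mul ℝ ℝ (r * (m - y))).convexOn convex_univ
    · simpa [Function.comp_def] using hψ.translate_right m
  have hWc : Continuous W := by fun_prop
  have hmin : ∀ s, W 0 ≤ W s := fun s => by simpa [hWdef] using hm s
  -- The constant left when the exponent of `tilt` is expanded at `m + s`; the quadratic term goes
  -- into the Gaussian density and the linear one into `W`.
  set C : ℝ := Real.sqrt (2 * Real.pi * v) * Real.exp (r * y * m - r * m ^ 2 / 2) with hC
  have hC0 : 0 ≤ C := by positivity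
  have hchange : ∀ f : ℝ → ℝ≥0∞, Measurable f → ∫⁻ t, f (t - m) * tilt r y t ∂expMeasure ψ =
      ENNReal.ofReal C * ∫⁻ s, f s * ENNReal.ofReal (Real.exp (-W s)) ∂gaussianReal 0 v := by
    intro f hf
    rw [lintegral_expMeasure hψc.measurable (by unfold tilt; fun_prop),
      ← lintegral_add_right_eq_self _ m,
      gaussianReal_of_var_ne_zero _ hv,
      lintegral_withDensity_eq_lintegral_mul _ (measurable_gaussianPDF _ _) (by fun_prop),
      ← lintegral_const_mul _
        ((measurable_gaussianPDF _ _).mul (by fun_prop))]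
    refine lintegral_congr fun s => ?_
    have h1 : Real.exp (-ψ (s + m)) * Real.exp (r * y * (s + m) - r * (s + m) ^ 2 / 2) =
        C * (gaussianPDFReal 0 v s * Real.exp (-W s)) := by
      have h4 : Real.sqrt (2 * Real.pi * v) ≠ 0 := by positivity
      rw [hC, gaussianPDFReal, hvr]
      rw [hvr] at h4
      field_simp
      rw [← Real.exp_add, ← Real.exp_add, ← Real.exp_add]
      congr 1
      simp only [hWdef]
      rw [add_comm m s]
      ring
    simp only [Pi.mul_apply, tilt, gaussianPDF, add_sub_cancel_right]
    calc
      _ = f s * ENNReal.ofReal (Real.exp (-ψ (s + m)) *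
            Real.exp (r * y * (s + m) - r * (s + m) ^ 2 / 2)) := by
          rw [ENNReal.ofReal_mul (by positivity)]; ring
      _ = _ := by
          rw [h1, ENNReal.ofReal_mul hC0, ENNReal.ofReal_mul (gaussianPDFReal_nonneg _ _ _)]; ring
  have h1 := hchange (fun s => ENNReal.ofReal (s ^ 2)) (by fun_prop)
  have h2 := hchange (fun _ => 1) measurable_const
  simp only [one_mul] at h2
  rw [h1, coordMass, h2, mul_left_comm]
  gcongr
  have hb : ∀ s, ‖Real.exp (-W s)‖ ≤ Real.exp (-W 0) := fun s => by
    rw [Real.norm_eq_abs, Real.abs_exp]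
    exact Real.exp_le_exp.2 (neg_le_neg (hmin s))
  have hi1 : Integrable (fun s => Real.exp (-W s)) (gaussianReal 0 v) :=
    Integrable.of_bound (by fun_prop) _ (ae_of_all _ hb)
  have hi2 : Integrable (fun s : ℝ => s ^ 2 * Real.exp (-W s)) (gaussianReal 0 v) :=
    (memLp_id_gaussianReal 2).integrable_sq.mul_bdd (by fun_prop) (ae_of_all _ hb)
  have key := integral_sq_sub_mul_nonpos hW hmin (v := v)
  simp_rw [sub_mul] at key
  rw [integral_sub hi2 (hi1.const_mul _), integral_const_mul, hvr] at key
  simp_rw [← ENNReal.ofReal_mul (sq_nonneg _)]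
  rw [← ofReal_integral_eq_lintegral_ofReal hi2 (ae_of_all _ fun s => by positivity),
    ← ofReal_integral_eq_lintegral_ofReal hi1 (ae_of_all _ fun s => by positivity),
    ← ENNReal.ofReal_mul (by positivity)]
  exact ENNReal.ofReal_le_ofReal (by linarith)

/-! ### Orthogonal designs -/

/-- The first `K` basis functions are orthogonal at the design points, with squared norm `n`. -/
def IsOrthDesign (φ : ℕ → unitInterval → ℝ) {n : ℕ} (x : Fin n → unitInterval) (K : ℕ) : Prop :=
  ∀ j < K, ∀ l < K, ∑ i, φ j (x i) * φ l (x i) = if j = l then (n : ℝ) else 0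

theorem isOrthDesign_of_designMatrix {φ : ℕ → unitInterval → ℝ} {n : ℕ} {x : Fin n → unitInterval}
    {K : ℕ} (h : (designMatrix φ x K).transpose * designMatrix φ x K =
      (n : ℝ) • (1 : Matrix (Fin K) (Fin K) ℝ)) : IsOrthDesign φ x K := by
  intro j hj l hl
  have := congrFun (congrFun h ⟨j, hj⟩) ⟨l, hl⟩
  simpa [Matrix.mul_apply, designMatrix, Matrix.one_apply] using this

/-- The empirical coefficient of the vector `v` with respect to the basis function `φ j`. -/
noncomputable def coef (φ : ℕ → unitInterval → ℝ) {n : ℕ} (x : Fin n → unitInterval)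
    (v : Fin n → ℝ) (j : ℕ) : ℝ :=
  (n : ℝ)⁻¹ * ∑ i, φ j (x i) * v i

variable {φ : ℕ → unitInterval → ℝ} {n : ℕ} {x : Fin n → unitInterval} {K : ℕ}

theorem coef_add (v w : Fin n → ℝ) (j : ℕ) :
    coef φ x (fun i => v i + w i) j = coef φ x v j + coef φ x w j := by
  simp [coef, mul_add, Finset.sum_add_distrib]

theorem coef_sub (v w : Fin n → ℝ) (j : ℕ) :
    coef φ x (fun i => v i - w i) j = coef φ x v j - coef φ x w j := by
  simp [coef, mul_sub, Finset.sum_sub_distrib]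

theorem IsOrthDesign.coef_sum (h : IsOrthDesign φ x K) (hn : n ≠ 0) {s : Finset ℕ}
    (hs : ∀ j ∈ s, j < K) (a : ℕ → ℝ) {j : ℕ} (hj : j < K) :
    coef φ x (fun i => ∑ l ∈ s, a l * φ l (x i)) j = if j ∈ s then a j else 0 := by
  have hn' : (n : ℝ) ≠ 0 := Nat.cast_ne_zero.2 hn
  have h1 : ∑ i, φ j (x i) * ∑ l ∈ s, a l * φ l (x i) = ∑ l ∈ s, a l * if j = l then (n : ℝ) else 0 := by
    simp_rw [Finset.mul_sum]
    rw [Finset.sum_comm]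
    refine Finset.sum_congr rfl fun l hl => ?_
    rw [← h j hj l (hs l hl), Finset.mul_sum]
    exact Finset.sum_congr rfl fun i _ => by ring
  rw [coef, h1]
  split_ifs with hjs
  · simp [hjs]
    field_simp
  · simp [hjs]

theorem sum_mul_sum_eq (v : Fin n → ℝ) (hn : n ≠ 0) (s : Finset ℕ) (a : ℕ → ℝ) :
    ∑ i, v i * ∑ j ∈ s, a j * φ j (x i) = n * ∑ j ∈ s, coef φ x v j * a j := by
  have hn' : (n : ℝ) ≠ 0 := Nat.cast_ne_zero.2 hn
  simp_rw [Finset.mul_sum]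
  rw [Finset.sum_comm]
  refine Finset.sum_congr rfl fun j _ => ?_
  rw [coef, ← mul_assoc, mul_inv_cancel_left₀ hn', Finset.sum_mul]
  exact Finset.sum_congr rfl fun i _ => by ring

theorem IsOrthDesign.sum_sq_sum (h : IsOrthDesign φ x K) (hn : n ≠ 0) {s : Finset ℕ}
    (hs : ∀ j ∈ s, j < K) (a : ℕ → ℝ) :
    ∑ i, (∑ j ∈ s, a j * φ j (x i)) ^ 2 = n * ∑ j ∈ s, a j ^ 2 := by
  simp_rw [sq (∑ j ∈ s, _)]
  rw [sum_mul_sum_eq _ hn]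
  congr 1
  refine Finset.sum_congr rfl fun j hj => ?_
  rw [h.coef_sum hn hs a (hs j hj), if_pos hj, sq]

/-- Bessel's inequality: the residual of the projection on the span has nonnegative squared norm. -/
theorem IsOrthDesign.bessel (h : IsOrthDesign φ x K) (hn : n ≠ 0) {s : Finset ℕ}
    (hs : ∀ j ∈ s, j < K) (v : Fin n → ℝ) :
    ∑ j ∈ s, coef φ x v j ^ 2 ≤ (n : ℝ)⁻¹ * ∑ i, v i ^ 2 := by
  have hn' : (0 : ℝ) < n := Nat.cast_pos.2 (Nat.pos_of_ne_zero hn)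
  have h0 : 0 ≤ ∑ i, (v i - ∑ j ∈ s, coef φ x v j * φ j (x i)) ^ 2 :=
    Finset.sum_nonneg fun i _ => sq_nonneg _
  have h1 : ∑ i, (v i - ∑ j ∈ s, coef φ x v j * φ j (x i)) ^ 2 =
      ∑ i, v i ^ 2 - n * ∑ j ∈ s, coef φ x v j ^ 2 := by
    have h2 := sum_mul_sum_eq (φ := φ) (x := x) v hn s (coef φ x v)
    have h3 := h.sum_sq_sum hn hs (coef φ x v)
    simp_rw [← sq] at h2
    simp_rw [sub_sq, Finset.sum_add_distrib, Finset.sum_sub_distrib, mul_assoc, ← Finset.mul_sum]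
    rw [h2, h3]
    ring
  rw [inv_mul_eq_div, le_div_iff₀ hn']
  linarith

/-- Bessel's inequality for the unit vector at each design point bounds the sum of `φ j (x i) ^ 2`
over `j` by `n`; summation over the design points gives `n * K ≤ n * n`. -/
theorem IsOrthDesign.le (h : IsOrthDesign φ x K) (hn : n ≠ 0) : K ≤ n := by
  have hn' : (0 : ℝ) < n := Nat.cast_pos.2 (Nat.pos_of_ne_zero hn)
  have h1 : ∀ i, ∑ j ∈ Finset.range K, φ j (x i) * φ j (x i) ≤ n := by
    intro i
    have := h.bessel hn (s := Finset.range K) (fun j hj => Finset.mem_range.1 hj) (Pi.single i 1)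
    simp only [coef, Pi.single_apply, mul_ite, mul_one, mul_zero, Finset.sum_ite_eq',
      Finset.mem_univ, if_true, mul_pow, ite_pow, one_pow, ne_eq, OfNat.ofNat_ne_zero,
      not_false_eq_true, zero_pow, ← Finset.mul_sum] at this
    simp_rw [← sq]
    have h2 : (n : ℝ)⁻¹ ^ 2 * ∑ j ∈ Finset.range K, φ j (x i) ^ 2 =
      (n : ℝ)⁻¹ * ((n : ℝ)⁻¹ * ∑ j ∈ Finset.range K, φ j (x i) ^ 2) := by ring
    rw [h2] at this
    have h3 := le_of_mul_le_mul_left (this.trans_eq (mul_one _).symm) (by positivity)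
    rwa [inv_mul_le_iff₀ hn', mul_one] at h3
  have h2 : ∑ i, ∑ j ∈ Finset.range K, φ j (x i) * φ j (x i) = n * K := by
    rw [Finset.sum_comm, Finset.sum_congr rfl fun j hj =>
      h j (Finset.mem_range.1 hj) j (Finset.mem_range.1 hj)]
    simp [mul_comm]
  have h3 : (n : ℝ) * K ≤ n * n := by
    rw [← h2]
    exact (Finset.sum_le_sum fun i _ => h1 i).trans_eq (by simp)
  exact_mod_cast le_of_mul_le_mul_left h3 hn'

/-! ### Regression functions with finitely many coefficients -/

theorem regFun_padZero {k : ℕ} (θ : Fin k → ℝ) (t : unitInterval) :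
    regFun φ (padZero θ) t = ∑ j ∈ Finset.range k, padZero θ j * φ j t := by
  refine tsum_eq_sum fun j hj => ?_
  rw [padZero, dif_neg (by simpa using hj), zero_mul]

theorem padZero_sub {k : ℕ} (θ θ' : Fin k → ℝ) (j : ℕ) :
    padZero θ j - padZero θ' j = padZero (fun j => θ j - θ' j) j := by
  unfold padZero; split_ifs <;> simp

theorem sum_range_padZero {k : ℕ} (θ : Fin k → ℝ) (f : ℕ → ℝ → ℝ) :
    ∑ j ∈ Finset.range k, f j (padZero θ j) = ∑ j : Fin k, f j (θ j) := by
  rw [Finset.sum_range]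
  exact Finset.sum_congr rfl fun j _ => by simp [padZero]

theorem IsOrthDesign.empDist_padZero (h : IsOrthDesign φ x K) (hn : n ≠ 0) {k : ℕ} (hk : k ≤ K)
    (θ θ' : Fin k → ℝ) :
    empDist φ x (padZero θ) (padZero θ') = Real.sqrt (∑ j, (θ j - θ' j) ^ 2) := by
  have hn' : (n : ℝ) ≠ 0 := Nat.cast_ne_zero.2 hn
  have h1 : ∀ i, regFun φ (padZero θ) (x i) - regFun φ (padZero θ') (x i) =
      ∑ j ∈ Finset.range k, padZero (fun j => θ j - θ' j) j * φ j (x i) := by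
    intro i
    rw [regFun_padZero, regFun_padZero, ← Finset.sum_sub_distrib]
    exact Finset.sum_congr rfl fun j _ => by rw [← sub_mul, padZero_sub]
  rw [empDist]
  simp_rw [h1]
  rw [h.sum_sq_sum hn fun j hj => (Finset.mem_range.1 hj).trans_le hk, inv_mul_cancel_left₀ hn',
    sum_range_padZero _ fun _ t => t ^ 2]

/-! ### Factorization of likelihood and posterior -/

theorem gaussianPDFReal_eq_mul_exp (a y : ℝ) :
    gaussianPDFReal a 1 y = gaussianPDFReal 0 1 y * Real.exp (y * a - a ^ 2 / 2) := by
  simp only [gaussianPDFReal, NNReal.coe_one, mul_one]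
  rw [mul_assoc, ← Real.exp_add]
  congr 2
  ring

/-- The density of pure noise. -/
noncomputable def noiseDensity (Y : Fin n → ℝ) : ℝ≥0∞ := ∏ i, gaussianPDF 0 1 (Y i)

theorem noiseDensity_ne_zero (Y : Fin n → ℝ) : noiseDensity Y ≠ 0 :=
  Finset.prod_ne_zero_iff.2 fun _ _ => (gaussianPDF_pos _ one_ne_zero _).ne'

theorem noiseDensity_ne_top (Y : Fin n → ℝ) : noiseDensity Y ≠ ∞ :=
  ENNReal.prod_ne_top fun _ _ => gaussianPDF_ne_top

/-- Relative to pure noise the log-likelihood is a linear term minus half a squared norm, and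
orthogonality removes the cross terms of the latter. -/
theorem IsOrthDesign.likelihood_padZero (h : IsOrthDesign φ x K) (hn : n ≠ 0) {k : ℕ} (hk : k ≤ K)
    (Y : Fin n → ℝ) (θ : Fin k → ℝ) :
    likelihood φ x Y (padZero θ) = noiseDensity Y * ∏ j : Fin k, tilt n (coef φ x Y j) (θ j) := by
  have h1 : ∀ i, gaussianPDF (regFun φ (padZero θ) (x i)) 1 (Y i) = gaussianPDF 0 1 (Y i) *
      ENNReal.ofReal (Real.exp (Y i * regFun φ (padZero θ) (x i) -
        regFun φ (padZero θ) (x i) ^ 2 / 2)) := by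
    intro i
    rw [gaussianPDF, gaussianPDFReal_eq_mul_exp,
      ENNReal.ofReal_mul (gaussianPDFReal_nonneg _ _ _)]
    rfl
  rw [likelihood, Finset.prod_congr rfl fun i _ => h1 i, Finset.prod_mul_distrib, noiseDensity]
  congr 1
  simp only [tilt]
  rw [← ENNReal.ofReal_prod_of_nonneg fun _ _ => (Real.exp_pos _).le, ← Real.exp_sum,
    ← ENNReal.ofReal_prod_of_nonneg fun _ _ => (Real.exp_pos _).le, ← Real.exp_sum]
  congr 2
  rw [Finset.sum_sub_distrib, Finset.sum_sub_distrib, ← Finset.sum_div, ← Finset.sum_div]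
  simp_rw [regFun_padZero]
  rw [sum_mul_sum_eq Y hn, h.sum_sq_sum hn fun j hj => (Finset.mem_range.1 hj).trans_le hk,
    sum_range_padZero _ fun j t => coef φ x Y j * t, sum_range_padZero _ fun _ t => t ^ 2,
    Finset.mul_sum, Finset.mul_sum]
  simp_rw [mul_assoc]

theorem measurable_prod_tilt {k : ℕ} (r : ℝ) (y : ℕ → ℝ) :
    Measurable fun θ : Fin k → ℝ => ∏ j : Fin k, tilt r (y j) (θ j) :=
  Finset.measurable_prod _ fun j _ => (measurable_tilt _ _).comp (measurable_pi_apply j)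

theorem IsOrthDesign.marginalLikelihood_eq (h : IsOrthDesign φ x K) (hn : n ≠ 0) {k : ℕ}
    (hk : k ≤ K) (g : Measure ℝ) [SigmaFinite g] (Y : Fin n → ℝ) :
    marginalLikelihood φ g x Y k =
      noiseDensity Y * ∏ j ∈ Finset.range k, coordMass g n (coef φ x Y j) := by
  simp_rw [marginalLikelihood, h.likelihood_padZero hn hk Y, prior]
  rw [lintegral_const_mul _ (measurable_prod_tilt _ _),
    lintegral_fin_prod fun _ => measurable_tilt _ _, Finset.prod_range]
  rfl

/-- The posterior distribution of one coordinate. -/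
noncomputable def coordPosterior (g : Measure ℝ) (r y : ℝ) : Measure ℝ :=
  (coordMass g r y)⁻¹ • g.withDensity (tilt r y)

theorem isProbabilityMeasure_coordPosterior {g : Measure ℝ} {r y : ℝ} (h0 : coordMass g r y ≠ 0)
    (h1 : coordMass g r y ≠ ∞) : IsProbabilityMeasure (coordPosterior g r y) := by
  refine ⟨?_⟩
  rw [coordPosterior, Measure.smul_apply, withDensity_apply _ MeasurableSet.univ,
    Measure.restrict_univ, smul_eq_mul]
  exact ENNReal.inv_mul_cancel h0 h1

theorem IsOrthDesign.posterior_eq (h : IsOrthDesign φ x K) (hn : n ≠ 0) {k : ℕ} (hk : k ≤ K)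
    {g : Measure ℝ} [SigmaFinite g] (h0 : ∀ y, coordMass g n y ≠ 0) (h1 : ∀ y, coordMass g n y ≠ ∞)
    (Y : Fin n → ℝ) :
    posterior φ g x Y k = Measure.pi fun j : Fin k => coordPosterior g n (coef φ x Y j) := by
  have : ∀ j : Fin k, SigmaFinite ((coordMass g n (coef φ x Y j))⁻¹ •
      g.withDensity (tilt n (coef φ x Y j))) := fun j => by
    have := isProbabilityMeasure_coordPosterior (h0 (coef φ x Y j)) (h1 _)
    unfold coordPosterior at this
    infer_instance
  simp_rw [coordPosterior]
  rw [pi_withDensity fun _ => measurable_tilt _ _, posterior, h.marginalLikelihood_eq hn hk]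
  simp_rw [h.likelihood_padZero hn hk Y, prior]
  have h2 : (fun θ : Fin k → ℝ => noiseDensity Y * ∏ j : Fin k, tilt n (coef φ x Y j) (θ j)) =
      noiseDensity Y • fun θ : Fin k → ℝ => ∏ j : Fin k, tilt n (coef φ x Y j) (θ j) := rfl
  rw [h2, withDensity_smul _ (measurable_prod_tilt _ _), smul_smul,
    ENNReal.mul_inv (Or.inl (noiseDensity_ne_zero Y)) (Or.inl (noiseDensity_ne_top Y)),
    mul_right_comm, ENNReal.inv_mul_cancel (noiseDensity_ne_zero Y) (noiseDensity_ne_top Y),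
    one_mul, Finset.prod_range, ENNReal.prod_inv_distrib]
  exact fun i _ j _ _ => Or.inl (h0 _)

/-! ### The radius of the credible ball -/

/-- The mean minimizes the second moment. This transfers the bound of `exists_center` from the mode
to the posterior mean. -/
theorem lintegral_sq_sub_mean_le {ν : Measure ℝ} [IsProbabilityMeasure ν] {m c : ℝ}
    (h : ∫⁻ t, ENNReal.ofReal ((t - m) ^ 2) ∂ν ≤ ENNReal.ofReal c) :
    ∫⁻ t, ENNReal.ofReal ((t - ∫ s, s ∂ν) ^ 2) ∂ν ≤ ENNReal.ofReal c := by
  have hint : Integrable (fun t => (t - m) ^ 2) ν := by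
    refine ⟨by fun_prop, (hasFiniteIntegral_iff_ofReal (ae_of_all _ fun t => sq_nonneg _)).2 ?_⟩
    exact h.trans_lt ENNReal.ofReal_lt_top
  have hL : MemLp (fun t => t - m) 2 ν := (memLp_two_iff_integrable_sq (by fun_prop)).2 hint
  have hL' : MemLp (fun t : ℝ => t) 2 ν := by
    simpa [Pi.add_def] using hL.add (memLp_const m)
  have h1 := evariance_eq_lintegral_ofReal (fun t : ℝ => t) ν
  rw [← h1, ← hL'.ofReal_variance_eq]
  refine le_trans ?_ h
  rw [← ofReal_integral_eq_lintegral_ofReal hint (ae_of_all _ fun t => sq_nonneg _),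
    ← variance_sub_const (by fun_prop) m]
  exact ENNReal.ofReal_le_ofReal (variance_le_expectation_sq (by fun_prop))

theorem empDist_nonneg (θ θ' : ℕ → ℝ) : 0 ≤ empDist φ x θ θ' := Real.sqrt_nonneg _

theorem nonneg_of_le_posterior_ball {g : Measure ℝ} {α : ℝ} (hα : α < 1) {Y : Fin n → ℝ} {k : ℕ}
    {b : ℕ → ℝ} {r : ℝ} (hr : ENNReal.ofReal (1 - α) ≤ posterior φ g x Y k
      {θ | empDist φ x (padZero θ) b ≤ r}) : 0 ≤ r := by
  by_contra! hr0
  have : {θ : Fin k → ℝ | empDist φ x (padZero θ) b ≤ r} = ∅ :=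
    Set.eq_empty_of_forall_notMem fun θ hθ => (hr0.trans_le (empDist_nonneg _ _)).not_ge hθ
  rw [this, measure_empty] at hr
  exact (ENNReal.ofReal_pos.2 (sub_pos.2 hα)).not_ge hr

theorem credibleRadius_nonneg {g : Measure ℝ} {α : ℝ} (hα : α < 1) (Y : Fin n → ℝ) (k : ℕ) :
    0 ≤ credibleRadius φ g x α Y k :=
  Real.sInf_nonneg fun _ hr => nonneg_of_le_posterior_ball hα hr

/-- The posterior expectation of the squared distance to the mean is at most `k / n`, as each of the
`k` coordinates has variance at most `1 / n`. Markov's inequality at level `α` gives the radius. -/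
theorem IsOrthDesign.credibleRadius_le (h : IsOrthDesign φ x K) (hn : n ≠ 0) {k : ℕ} (hk : k ≤ K)
    (hk0 : k ≠ 0) {ψ : ℝ → ℝ} (hψ : ConvexOn ℝ Set.univ ψ) {G : ℝ}
    (hG : ∀ t, Real.exp (-ψ t) ≤ G) {α : ℝ} (hα : α ∈ Set.Ioo (0 : ℝ) 1) (Y : Fin n → ℝ) :
    credibleRadius φ (expMeasure ψ) x α Y k ≤ Real.sqrt (k / (n * α)) := by
  have hn' : (0 : ℝ) < n := Nat.cast_pos.2 (Nat.pos_of_ne_zero hn)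
  have hk' : (0 : ℝ) < k := Nat.cast_pos.2 (Nat.pos_of_ne_zero hk0)
  have hψm := (continuous_of_convexOn_univ hψ).measurable
  have h0 : ∀ y, coordMass (expMeasure ψ) n y ≠ 0 := fun y => coordMass_ne_zero hψm _ y
  have h1 : ∀ y, coordMass (expMeasure ψ) n y ≠ ∞ := fun y =>
    ((coordMass_le hψ hG hn' y).trans_lt ENNReal.ofReal_lt_top).ne
  have hprob := fun y => isProbabilityMeasure_coordPosterior (h0 y) (h1 y)
  have hpost := h.posterior_eq hn hk h0 h1 Y
  set ν : Fin k → Measure ℝ := fun j => coordPosterior (expMeasure ψ) n (coef φ x Y j) with hν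
  have hmean : ∀ j, posteriorMean φ (expMeasure ψ) x Y k j = ∫ t, t ∂ν j := by
    intro j
    rw [posteriorMean, hpost]
    exact integral_comp_eval (μ := ν) (i := j) (f := fun t => t) (by fun_prop)
  set b := posteriorMean φ (expMeasure ψ) x Y k
  have hvar : ∀ j, ∫⁻ t, ENNReal.ofReal ((t - b j) ^ 2) ∂ν j ≤ ENNReal.ofReal (n : ℝ)⁻¹ := by
    intro j
    obtain ⟨m, hm⟩ := exists_center hψ hG hn' (coef φ x Y j)
    rw [hmean j]
    refine lintegral_sq_sub_mean_le (m := m) ?_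
    rw [hν]
    simp only [coordPosterior]
    rw [lintegral_smul_measure, lintegral_withDensity_eq_lintegral_mul _ (measurable_tilt _ _)
      (by fun_prop), smul_eq_mul, ← ENNReal.div_eq_inv_mul]
    refine ENNReal.div_le_of_le_mul ?_
    refine le_trans (le_of_eq ?_) hm
    refine lintegral_congr fun t => ?_
    rw [Pi.mul_apply, mul_comm]
  set R : ℝ := k / (n * α) with hR
  have hR0 : 0 < R := div_pos hk' (mul_pos hn' hα.1)
  set S : (Fin k → ℝ) → ℝ := fun θ => ∑ j, (θ j - b j) ^ 2 with hS
  have hSm : Measurable S := by fun_prop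
  have hlint : ∫⁻ θ, ENNReal.ofReal (S θ) ∂(Measure.pi ν) ≤ ENNReal.ofReal (k / n) := by
    simp_rw [hS, ENNReal.ofReal_sum_of_nonneg fun j _ => sq_nonneg _]
    rw [lintegral_finsetSum _ fun j _ => by fun_prop]
    calc
      _ ≤ ∑ j : Fin k, ENNReal.ofReal (n : ℝ)⁻¹ := by
          refine Finset.sum_le_sum fun j _ => le_trans (le_of_eq ?_) (hvar j)
          exact (measurePreserving_eval ν j).lintegral_comp
            (f := fun t => ENNReal.ofReal ((t - b j) ^ 2)) (by fun_prop)
      _ = ENNReal.ofReal (k / n) := by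
          rw [Finset.sum_const, Finset.card_univ, Fintype.card_fin, nsmul_eq_mul, div_eq_mul_inv,
            ENNReal.ofReal_mul hk'.le, ENNReal.ofReal_natCast]
  have hmarkov : Measure.pi ν {θ | R ≤ S θ} ≤ ENNReal.ofReal α := by
    have h2 := mul_meas_ge_le_lintegral (μ := Measure.pi ν) hSm.ennreal_ofReal (ENNReal.ofReal R)
    have h3 : {θ | R ≤ S θ} ⊆ {θ | ENNReal.ofReal R ≤ ENNReal.ofReal (S θ)} :=
      fun θ hθ => ENNReal.ofReal_le_ofReal hθ
    have h4 : ENNReal.ofReal R * Measure.pi ν {θ | R ≤ S θ} ≤ ENNReal.ofReal R * ENNReal.ofReal α :=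
      calc
        _ ≤ ENNReal.ofReal (k / n) := (mul_le_mul_right (measure_mono h3) _).trans (h2.trans hlint)
        _ = _ := by
          rw [← ENNReal.ofReal_mul hR0.le, hR]
          congr 1
          have := hα.1.ne'
          field_simp
    exact (ENNReal.mul_le_mul_iff_right (ENNReal.ofReal_pos.2 hR0).ne' ENNReal.ofReal_ne_top).1 h4
  refine csInf_le ⟨0, fun r hr => nonneg_of_le_posterior_ball hα.2 hr⟩ ?_
  rw [Set.mem_ofPred_eq, hpost]
  have hsub : {θ | R ≤ S θ}ᶜ ⊆ {θ | empDist φ x (padZero θ) (padZero b) ≤ Real.sqrt R} := by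
    intro θ hθ
    rw [Set.mem_ofPred_eq, h.empDist_padZero hn hk]
    exact Real.sqrt_le_sqrt (le_of_not_ge hθ)
  refine le_trans ?_ (measure_mono hsub)
  rw [prob_compl_eq_one_sub (measurableSet_le measurable_const hSm),
    ENNReal.ofReal_sub _ hα.1.le, ENNReal.ofReal_one]
  exact tsub_le_tsub_left hmarkov _

/-! ### Truncation of the regression function -/

/-- The part of the series `f_θ` with indices at least `K`. -/
noncomputable def tailFun (φ : ℕ → unitInterval → ℝ) (θ : ℕ → ℝ) (K : ℕ) (t : unitInterval) : ℝ :=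
  ∑' l, θ (l + K) * φ (l + K) t

theorem regFun_eq_sum_add_tailFun {θ : ℕ → ℝ} {t : unitInterval}
    (hs : Summable fun j => θ j * φ j t) (K : ℕ) :
    regFun φ θ t = ∑ j ∈ Finset.range K, θ j * φ j t + tailFun φ θ K t :=
  (hs.sum_add_tsum_nat_add K).symm

/-- The increment of the integral test, in telescoping form; it follows from `log t ≤ t - 1` and `1
+ t ≤ exp t`. -/
theorem mul_rpow_le_sub {q : ℝ} (hq : 0 < q) {u : ℝ} (hu : 0 < u) :
    q * (u + 1) ^ (-q - 1) ≤ u ^ (-q) - (u + 1) ^ (-q) := by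
  have hu1 : 0 < u + 1 := by linarith
  have h1 : Real.log (u / (u + 1)) ≤ -(u + 1)⁻¹ := by
    have := Real.log_le_sub_one_of_pos (div_pos hu hu1)
    have h2 : u / (u + 1) - 1 = -(u + 1)⁻¹ := by field_simp; ring
    linarith
  have h2 : u ^ (-q) = (u + 1) ^ (-q) * (u / (u + 1)) ^ (-q) := by
    rw [← Real.mul_rpow hu1.le (by positivity), mul_div_cancel₀ _ hu1.ne']
  have h3 : 1 + q * (u + 1)⁻¹ ≤ (u / (u + 1)) ^ (-q) := by
    rw [Real.rpow_def_of_pos (by positivity)]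
    refine le_trans ?_ (Real.add_one_le_exp _)
    nlinarith
  have h4 : (u + 1) ^ (-q - 1) = (u + 1) ^ (-q) * (u + 1)⁻¹ := by
    rw [Real.rpow_sub_one hu1.ne', div_eq_mul_inv]
  rw [h2, h4]
  have := mul_le_mul_of_nonneg_left h3 (by positivity : 0 ≤ (u + 1) ^ (-q))
  linarith

theorem summable_and_tsum_rpow_le {q : ℝ} (hq : 0 < q) {K : ℕ} (hK : K ≠ 0) :
    (Summable fun l : ℕ => (((l + K : ℕ) : ℝ) + 1) ^ (-q - 1)) ∧
      ∑' l : ℕ, (((l + K : ℕ) : ℝ) + 1) ^ (-q - 1) ≤ q⁻¹ * (K : ℝ) ^ (-q) := by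
  have hK' : (0 : ℝ) < K := Nat.cast_pos.2 (Nat.pos_of_ne_zero hK)
  have h0 : ∀ l : ℕ, 0 ≤ (((l + K : ℕ) : ℝ) + 1) ^ (-q - 1) := fun l => by positivity
  have h1 : ∀ N : ℕ, ∑ l ∈ Finset.range N, (((l + K : ℕ) : ℝ) + 1) ^ (-q - 1) ≤
      q⁻¹ * (K : ℝ) ^ (-q) := by
    intro N
    have h2 : ∑ l ∈ Finset.range N, (((l + K : ℕ) : ℝ) + 1) ^ (-q - 1) ≤
        q⁻¹ * ((K : ℝ) ^ (-q) - ((N + K : ℕ) : ℝ) ^ (-q)) := by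
      induction N with
      | zero => simp
      | succ N ih =>
        rw [Finset.sum_range_succ]
        have h3 := mul_rpow_le_sub hq (u := ((N + K : ℕ) : ℝ)) (by positivity)
        rw [← le_div_iff₀' hq, div_eq_inv_mul] at h3
        have h4 : ((N + 1 + K : ℕ) : ℝ) = ((N + K : ℕ) : ℝ) + 1 := by push_cast; ring
        rw [h4]
        linarith
    refine h2.trans ?_
    have : 0 ≤ ((N + K : ℕ) : ℝ) ^ (-q) := by positivity
    gcongr
    linarith
  exact ⟨summable_of_sum_range_le h0 h1, Real.tsum_le_of_sum_range_le h0 h1⟩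

/-- Ensures that the `tsum` in `regFun` is a genuine sum rather than its default value `0`. -/
theorem selfSimilar.summable {β L B : ℝ} (hβ : 1 / 2 < β) (hφ : ∀ j t, |φ j t| ≤ B) {θ : ℕ → ℝ}
    (hθ : θ ∈ selfSimilar β L) (t : unitInterval) : Summable fun j => θ j * φ j t := by
  have hB : 0 ≤ B := (abs_nonneg _).trans (hφ 0 t)
  rw [← summable_nat_add_iff 1]
  refine Summable.of_norm_bounded
    (((summable_and_tsum_rpow_le (sub_pos.2 hβ) one_ne_zero).1.mul_left L).mul_right B) fun l => ?_
  rw [norm_mul]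
  have := (hθ (l + 1)).2
  rw [show -β - 1 / 2 = -(β - 1 / 2) - 1 by ring] at this
  exact mul_le_mul this (hφ _ _) (norm_nonneg _) ((abs_nonneg _).trans this)

theorem selfSimilar.abs_tailFun_le {β L B : ℝ} (hβ : 1 / 2 < β) (hL : 0 < L)
    (hφ : ∀ j t, |φ j t| ≤ B) {θ : ℕ → ℝ} (hθ : θ ∈ selfSimilar β L) (hK : K ≠ 0)
    (t : unitInterval) :
    |tailFun φ θ K t| ≤ L * B * (β - 1 / 2)⁻¹ * (K : ℝ) ^ (-(β - 1 / 2)) := by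
  have hB : 0 ≤ B := (abs_nonneg _).trans (hφ 0 t)
  obtain ⟨h1, h2⟩ := summable_and_tsum_rpow_le (sub_pos.2 hβ) hK
  have h3 : ∀ l, ‖θ (l + K) * φ (l + K) t‖ ≤
      L * B * (((l + K : ℕ) : ℝ) + 1) ^ (-(β - 1 / 2) - 1) := by
    intro l
    rw [norm_mul, mul_right_comm]
    have := (hθ (l + K)).2
    rw [show -β - 1 / 2 = -(β - 1 / 2) - 1 by ring] at this
    exact mul_le_mul this (hφ _ _) (norm_nonneg _) ((abs_nonneg _).trans this)
  have h4 := tsum_of_norm_bounded (h1.mul_left (L * B)).hasSum h3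
  rw [tsum_mul_left] at h4
  refine h4.trans ?_
  rw [mul_assoc (L * B)]
  gcongr

/-- Bias bound: no element of the model `Θ(k)` affects the empirical coefficients with index in `[k,
K)`. There `θ j` is the coefficient of the difference of the regression functions minus that of the
tail, and Bessel's inequality bounds both contributions. -/
theorem IsOrthDesign.sum_sq_le_empDist (h : IsOrthDesign φ x K) (hn : n ≠ 0) {k : ℕ} (hk : k ≤ K)
    {θ : ℕ → ℝ} (hs : ∀ t, Summable fun j => θ j * φ j t) {T : ℝ}
    (hT : ∀ t, |tailFun φ θ K t| ≤ T) (θ' : Fin k → ℝ) :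
    ∑ j ∈ Finset.Ico k K, θ j ^ 2 ≤ 2 * empDist φ x θ (padZero θ') ^ 2 + 2 * T ^ 2 := by
  have hn' : (0 : ℝ) < n := Nat.cast_pos.2 (Nat.pos_of_ne_zero hn)
  have hlt : ∀ j ∈ Finset.Ico k K, j < K := fun j hj => (Finset.mem_Ico.1 hj).2
  set v : Fin n → ℝ := fun i => regFun φ θ (x i) - regFun φ (padZero θ') (x i) with hv
  set w : Fin n → ℝ := fun i => tailFun φ θ K (x i) with hw
  have hcoef : ∀ j ∈ Finset.Ico k K, θ j = coef φ x v j - coef φ x w j := by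
    intro j hj
    have h1 : v = fun i => (∑ l ∈ Finset.range K, θ l * φ l (x i) + w i) -
        ∑ l ∈ Finset.range k, padZero θ' l * φ l (x i) := by
      ext i
      rw [hv, hw]
      simp only
      rw [regFun_eq_sum_add_tailFun (hs _) K, regFun_padZero]
    rw [h1, coef_sub, coef_add, h.coef_sum hn (fun l hl => Finset.mem_range.1 hl) _ (hlt j hj),
      h.coef_sum hn (fun l hl => (Finset.mem_range.1 hl).trans_le hk) _ (hlt j hj),
      if_pos (Finset.mem_range.2 (hlt j hj)), if_neg (by simpa using (Finset.mem_Ico.1 hj).1)]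
    ring
  have h1 : ∑ j ∈ Finset.Ico k K, coef φ x v j ^ 2 ≤ empDist φ x θ (padZero θ') ^ 2 := by
    rw [empDist, Real.sq_sqrt (by positivity)]
    exact h.bessel hn hlt v
  have h2 : ∑ j ∈ Finset.Ico k K, coef φ x w j ^ 2 ≤ T ^ 2 := by
    refine (h.bessel hn hlt w).trans ?_
    rw [inv_mul_le_iff₀ hn']
    calc
      _ ≤ ∑ _i : Fin n, T ^ 2 := Finset.sum_le_sum fun i _ => sq_le_sq' (abs_le.1 (hT _)).1 (abs_le.1 (hT _)).2
      _ = n * T ^ 2 := by simp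
  calc
    _ ≤ ∑ j ∈ Finset.Ico k K, (2 * coef φ x v j ^ 2 + 2 * coef φ x w j ^ 2) := by
        refine Finset.sum_le_sum fun j hj => ?_
        rw [hcoef j hj]
        nlinarith [sq_nonneg (coef φ x v j + coef φ x w j)]
    _ ≤ _ := by
        rw [Finset.sum_add_distrib, ← Finset.mul_sum, ← Finset.mul_sum]
        gcongr

/-! ### Overfitting requires large noise -/

/-- The ratio of the two marginal likelihoods is the product of `coordMass` over `[κ, k)`, which
must be at least `1`; take logarithms in `coordMass_le`. -/
theorem IsOrthDesign.le_sum_coef_sq (h : IsOrthDesign φ x K) (hn : n ≠ 0) {ψ : ℝ → ℝ}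
    (hψ : ConvexOn ℝ Set.univ ψ) {G : ℝ} (hG : ∀ t, Real.exp (-ψ t) ≤ G) {κ k : ℕ} (hκ : κ ≤ k)
    (hk : k ≤ K) {Y : Fin n → ℝ} (hle : marginalLikelihood φ (expMeasure ψ) x Y κ ≤
      marginalLikelihood φ (expMeasure ψ) x Y k) :
    ((k : ℝ) - κ) * (Real.log n - 2 * Real.log (G * Real.sqrt (2 * Real.pi))) ≤
      ∑ j ∈ Finset.Ico κ k, n * coef φ x Y j ^ 2 := by
  have hn' : (0 : ℝ) < n := Nat.cast_pos.2 (Nat.pos_of_ne_zero hn)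
  have hG0 : 0 < G := (Real.exp_pos _).trans_le (hG 0)
  have hψm := (continuous_of_convexOn_univ hψ).measurable
  have h0 : ∀ y, coordMass (expMeasure ψ) n y ≠ 0 := fun y => coordMass_ne_zero hψm _ y
  have h1 : ∀ y, coordMass (expMeasure ψ) n y ≠ ∞ := fun y =>
    ((coordMass_le hψ hG hn' y).trans_lt ENNReal.ofReal_lt_top).ne
  rw [h.marginalLikelihood_eq hn (hκ.trans hk), h.marginalLikelihood_eq hn hk,
    ENNReal.mul_le_mul_iff_right (noiseDensity_ne_zero Y) (noiseDensity_ne_top Y),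
    ← Finset.prod_range_mul_prod_Ico _ hκ] at hle
  have h2 : 1 ≤ ∏ j ∈ Finset.Ico κ k, coordMass (expMeasure ψ) n (coef φ x Y j) := by
    refine (ENNReal.mul_le_mul_iff_right ?_ ?_).1 ((mul_one _).trans_le hle)
    · exact Finset.prod_ne_zero_iff.2 fun _ _ => h0 _
    · exact ENNReal.prod_ne_top fun _ _ => h1 _
  have h3 : 1 ≤ ∏ j ∈ Finset.Ico κ k, (G * Real.sqrt (2 * Real.pi / n) *
      Real.exp (n * coef φ x Y j ^ 2 / 2)) := by
    rw [← ENNReal.one_le_ofReal, ENNReal.ofReal_prod_of_nonneg fun _ _ => by positivity]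
    exact h2.trans (Finset.prod_le_prod' fun j _ => coordMass_le hψ hG hn' _)
  have h4 := Real.log_nonneg h3
  rw [Real.log_prod fun j _ => by positivity] at h4
  have h5 : ∀ j ∈ Finset.Ico κ k, Real.log (G * Real.sqrt (2 * Real.pi / n) *
      Real.exp (n * coef φ x Y j ^ 2 / 2)) = (n * coef φ x Y j ^ 2) / 2 -
        (Real.log n - 2 * Real.log (G * Real.sqrt (2 * Real.pi))) / 2 := by
    intro j _
    rw [Real.sqrt_div' _ hn'.le, ← mul_div_assoc, Real.log_mul (by positivity) (by positivity),
      Real.log_div (by positivity) (by positivity), Real.log_exp, Real.log_sqrt hn'.le]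
    ring
  rw [Finset.sum_congr rfl h5, Finset.sum_sub_distrib, ← Finset.sum_div, Finset.sum_const,
    Nat.card_Ico, nsmul_eq_mul, Nat.cast_sub hκ] at h4
  linarith

/-- The lower bound does not involve `k`, so a single random variable handles all overfitted models
and no union bound is needed. The weights `1 / (j + 1)` make this possible: they are at least `1 /
k` for `j < k`, and their sum is only logarithmic. -/
theorem IsOrthDesign.le_sum_noise (h : IsOrthDesign φ x K) (hn : n ≠ 0) {ψ : ℝ → ℝ}
    (hψ : ConvexOn ℝ Set.univ ψ) {G : ℝ} (hG : ∀ t, Real.exp (-ψ t) ≤ G) {κ k : ℕ}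
    (hκ : 2 * κ < k) (hk : k ≤ K) {Y : Fin n → ℝ}
    (hle : marginalLikelihood φ (expMeasure ψ) x Y κ ≤ marginalLikelihood φ (expMeasure ψ) x Y k)
    {θ : ℕ → ℝ} (hs : ∀ t, Summable fun j => θ j * φ j t) {T : ℝ}
    (hT : ∀ t, |tailFun φ θ K t| ≤ T)
    (hlog : 2 * Real.log (G * Real.sqrt (2 * Real.pi)) ≤ Real.log n / 4)
    (hθ : ∀ j, κ ≤ j → n * θ j ^ 2 ≤ Real.log n / 36) (hTn : n * T ^ 2 ≤ κ * Real.log n / 36) :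
    Real.log n ^ 2 / 72 ≤ ∑ j ∈ Finset.range K,
      (n : ℝ) ^ 2 * coef φ x (fun i => Y i - regFun φ θ (x i)) j ^ 4 * ((j : ℝ) + 1)⁻¹ := by
  have hn' : (0 : ℝ) < n := Nat.cast_pos.2 (Nat.pos_of_ne_zero hn)
  have hlogn : 0 ≤ Real.log n := Real.log_natCast_nonneg n
  have hκk : κ ≤ k := by omega
  have hk0 : (0 : ℝ) < k := by exact_mod_cast (Nat.zero_le _).trans_lt hκ
  have hκk' : 2 * (κ : ℝ) ≤ k := by exact_mod_cast hκ.le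
  have hlt : ∀ j ∈ Finset.Ico κ k, j < K := fun j hj => (Finset.mem_Ico.1 hj).2.trans_le hk
  set D : ℝ := (k : ℝ) - κ with hD
  have hD0 : 0 < D := by
    have : (κ : ℝ) < k := by exact_mod_cast (show κ < k by omega)
    linarith
  have hcard : ((Finset.Ico κ k).card : ℝ) = D := by rw [Nat.card_Ico, Nat.cast_sub hκk]
  set w : Fin n → ℝ := fun i => tailFun φ θ K (x i) with hw
  set e : Fin n → ℝ := fun i => Y i - regFun φ θ (x i) with he
  have hcoef : ∀ j ∈ Finset.Ico κ k, coef φ x Y j = θ j + coef φ x w j + coef φ x e j := by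
    intro j hj
    have h1 : Y = fun i => (∑ l ∈ Finset.range K, θ l * φ l (x i) + w i) + e i := by
      ext i
      simp only [he, hw]
      rw [regFun_eq_sum_add_tailFun (hs _) K]
      ring
    conv_lhs => rw [h1]
    rw [coef_add, coef_add, h.coef_sum hn (fun l hl => Finset.mem_range.1 hl) _ (hlt j hj),
      if_pos (Finset.mem_range.2 (hlt j hj))]
  have h1 := h.le_sum_coef_sq hn hψ hG hκk hk hle
  have h2 : ∑ j ∈ Finset.Ico κ k, n * coef φ x Y j ^ 2 ≤
      3 * (∑ j ∈ Finset.Ico κ k, n * θ j ^ 2 + n * ∑ j ∈ Finset.Ico κ k, coef φ x w j ^ 2 +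
        ∑ j ∈ Finset.Ico κ k, n * coef φ x e j ^ 2) := by
    rw [Finset.mul_sum, ← Finset.sum_add_distrib, ← Finset.sum_add_distrib, Finset.mul_sum]
    refine Finset.sum_le_sum fun j hj => ?_
    rw [hcoef j hj]
    have : (θ j + coef φ x w j + coef φ x e j) ^ 2 ≤
        3 * (θ j ^ 2 + coef φ x w j ^ 2 + coef φ x e j ^ 2) := by
      nlinarith [sq_nonneg (θ j - coef φ x w j), sq_nonneg (θ j - coef φ x e j),
        sq_nonneg (coef φ x w j - coef φ x e j)]
    nlinarith
  have h3 : ∑ j ∈ Finset.Ico κ k, n * θ j ^ 2 ≤ D * (Real.log n / 36) := by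
    refine (Finset.sum_le_sum fun j hj => hθ j (Finset.mem_Ico.1 hj).1).trans_eq ?_
    rw [Finset.sum_const, nsmul_eq_mul, hcard]
  have h4 : n * ∑ j ∈ Finset.Ico κ k, coef φ x w j ^ 2 ≤ D * (Real.log n / 36) := by
    have h5 : ∑ j ∈ Finset.Ico κ k, coef φ x w j ^ 2 ≤ T ^ 2 := by
      refine (h.bessel hn hlt w).trans ?_
      rw [inv_mul_le_iff₀ hn']
      calc
        _ ≤ ∑ _i : Fin n, T ^ 2 :=
          Finset.sum_le_sum fun i _ => sq_le_sq' (abs_le.1 (hT _)).1 (abs_le.1 (hT _)).2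
        _ = n * T ^ 2 := by simp
    have h6 : (κ : ℝ) * Real.log n ≤ D * Real.log n := by gcongr; linarith
    have := mul_le_mul_of_nonneg_left h5 hn'.le
    linarith
  set s := ∑ j ∈ Finset.Ico κ k, n * coef φ x e j ^ 2 with hsdef
  -- From `3 / 4 ≤ 3 * (1 / 36 + 1 / 36) + 3 * s / (D * log n)` the noise share is at least `7 /
  -- 36`, which exceeds `1 / 6`.
  have h5 : D * (Real.log n / 6) ≤ s := by
    have h6 : D * (3 * Real.log n / 4) ≤
        D * (Real.log n - 2 * Real.log (G * Real.sqrt (2 * Real.pi))) := by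
      gcongr; linarith
    have h7 : 0 ≤ D * Real.log n := by positivity
    linarith
  have h6 : s ^ 2 ≤ D * ∑ j ∈ Finset.Ico κ k, (n * coef φ x e j ^ 2) ^ 2 := by
    rw [← hcard]
    exact sq_sum_le_card_mul_sum_sq
  have h7 : D * (Real.log n / 6) ^ 2 ≤ ∑ j ∈ Finset.Ico κ k, (n * coef φ x e j ^ 2) ^ 2 := by
    have h8 : (D * (Real.log n / 6)) ^ 2 ≤ s ^ 2 := by gcongr
    refine le_of_mul_le_mul_left ?_ hD0
    linarith
  calc
    -- Here `2 * κ < k` enters as `D ≥ k / 2`.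
    Real.log n ^ 2 / 72 ≤ (k : ℝ)⁻¹ * (D * (Real.log n / 6) ^ 2) := by
        rw [inv_mul_eq_div, le_div_iff₀ hk0]
        have : 0 ≤ Real.log n ^ 2 := sq_nonneg _
        nlinarith
    _ ≤ (k : ℝ)⁻¹ * ∑ j ∈ Finset.Ico κ k, (n * coef φ x e j ^ 2) ^ 2 := by gcongr
    _ ≤ ∑ j ∈ Finset.Ico κ k, (n : ℝ) ^ 2 * coef φ x e j ^ 4 * ((j : ℝ) + 1)⁻¹ := by
        rw [Finset.mul_sum]
        refine Finset.sum_le_sum fun j hj => ?_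
        rw [show (n * coef φ x e j ^ 2) ^ 2 = (n : ℝ) ^ 2 * coef φ x e j ^ 4 by ring, mul_comm]
        gcongr
        exact_mod_cast (Finset.mem_Ico.1 hj).2
    _ ≤ _ := by
        refine Finset.sum_le_sum_of_subset_of_nonneg ?_ fun j _ _ => by positivity
        intro j hj
        exact Finset.mem_range.2 (hlt j hj)

/-! ### Moments of the noise -/

theorem lintegral_exp_gaussianReal (a c : ℝ) :
    ∫⁻ y, ENNReal.ofReal (Real.exp (a * (y - c))) ∂gaussianReal c 1 =
      ENNReal.ofReal (Real.exp (a ^ 2 / 2)) := by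
  have h1 : ∀ y : ℝ, Real.exp (a * (y - c)) = Real.exp (a * y) * Real.exp (-(a * c)) := fun y => by
    rw [← Real.exp_add]; ring_nf
  rw [← ofReal_integral_eq_lintegral_ofReal _ (ae_of_all _ fun _ => (Real.exp_pos _).le)]
  · congr 1
    simp_rw [h1]
    rw [integral_mul_const]
    have h2 := congrFun (mgf_fun_id_gaussianReal (μ := c) (v := 1)) a
    rw [mgf] at h2
    rw [h2, ← Real.exp_add]
    congr 1
    simp only [NNReal.coe_one]
    ring
  · simp_rw [h1]
    exact (integrable_exp_mul_gaussianReal a).mul_const _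

theorem lintegral_exp_sum_noise (θ : ℕ → ℝ) (a : Fin n → ℝ) :
    ∫⁻ Y, ENNReal.ofReal (Real.exp (∑ i, a i * (Y i - regFun φ θ (x i)))) ∂dataLaw φ x θ =
      ENNReal.ofReal (Real.exp ((∑ i, a i ^ 2) / 2)) := by
  simp_rw [Real.exp_sum, ENNReal.ofReal_prod_of_nonneg fun _ _ => (Real.exp_pos _).le]
  rw [dataLaw, lintegral_fin_prod (f := fun i y =>
    ENNReal.ofReal (Real.exp (a i * (y - regFun φ θ (x i))))) fun i => by fun_prop]
  simp_rw [lintegral_exp_gaussianReal]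
  rw [← ENNReal.ofReal_prod_of_nonneg fun _ _ => (Real.exp_pos _).le, ← Real.exp_sum,
    Finset.sum_div]

theorem pow_four_le_exp (z : ℝ) : z ^ 4 ≤ 24 * (Real.exp z + Real.exp (-z)) := by
  have h1 := Real.pow_div_factorial_le_exp |z| (abs_nonneg z) 4
  have h2 : Real.exp |z| ≤ Real.exp z + Real.exp (-z) := by
    rcases abs_choice z with h | h <;> rw [h]
    · linarith [Real.exp_pos (-z)]
    · linarith [Real.exp_pos z]
  have h3 : |z| ^ 4 = z ^ 4 := by rw [← abs_pow]; exact abs_of_nonneg (by positivity)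
  rw [h3] at h1
  norm_num [Nat.factorial] at h1
  linarith

theorem measurable_coef_noise (θ : ℕ → ℝ) (j : ℕ) :
    Measurable fun Y : Fin n → ℝ => coef φ x (fun i => Y i - regFun φ θ (x i)) j := by
  unfold coef; fun_prop

/-- The rescaled noise coefficient is a unit-norm linear form in standard normal variables.
Exponential moments give the crude value `96 = 24 * 2 * 2` through `pow_four_le_exp` and `exp (1 /
2) ≤ 2`. -/
theorem IsOrthDesign.lintegral_noise_pow_four_le (h : IsOrthDesign φ x K) (hn : n ≠ 0) (θ : ℕ → ℝ)
    {j : ℕ} (hj : j < K) :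
    ∫⁻ Y, ENNReal.ofReal ((n : ℝ) ^ 2 * coef φ x (fun i => Y i - regFun φ θ (x i)) j ^ 4)
      ∂dataLaw φ x θ ≤ ENNReal.ofReal 96 := by
  have hn' : (0 : ℝ) < n := Nat.cast_pos.2 (Nat.pos_of_ne_zero hn)
  set a : Fin n → ℝ := fun i => (Real.sqrt n)⁻¹ * φ j (x i) with ha
  have hsq : Real.sqrt n ^ 2 = n := Real.sq_sqrt hn'.le
  have hs0 : Real.sqrt n ≠ 0 := by positivity
  have ha2 : ∑ i, a i ^ 2 = 1 := by
    simp_rw [ha, mul_pow]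
    rw [← Finset.mul_sum]
    simp_rw [sq (φ j _)]
    rw [h j hj j hj, if_pos rfl, inv_pow, hsq, inv_mul_cancel₀ hn'.ne']
  have ha2' : ∑ i, (-a i) ^ 2 = 1 := by simpa using ha2
  have hz : ∀ Y : Fin n → ℝ, (n : ℝ) ^ 2 * coef φ x (fun i => Y i - regFun φ θ (x i)) j ^ 4 =
      (∑ i, a i * (Y i - regFun φ θ (x i))) ^ 4 := by
    intro Y
    have : ∑ i, a i * (Y i - regFun φ θ (x i)) =
        Real.sqrt n * coef φ x (fun i => Y i - regFun φ θ (x i)) j := by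
      rw [coef, ← mul_assoc, Finset.mul_sum]
      refine Finset.sum_congr rfl fun i _ => ?_
      have : Real.sqrt n * (n : ℝ)⁻¹ = (Real.sqrt n)⁻¹ := by
        rw [← hsq, Real.sqrt_sq (Real.sqrt_nonneg _)]
        field_simp
      rw [this, ha]
      ring
    rw [this, mul_pow, show Real.sqrt n ^ 4 = (Real.sqrt n ^ 2) ^ 2 by ring, hsq]
  have hexp : Real.exp (1 / 2) ≤ 2 := by
    have h1 := Real.exp_one_lt_d9
    have h2 : Real.exp (1 / 2) ^ 2 = Real.exp 1 := by rw [← Real.exp_nat_mul]; norm_num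
    nlinarith [Real.exp_pos (1 / 2)]
  calc
    _ ≤ ∫⁻ Y, ENNReal.ofReal 24 *
          (ENNReal.ofReal (Real.exp (∑ i, a i * (Y i - regFun φ θ (x i)))) +
            ENNReal.ofReal (Real.exp (∑ i, -a i * (Y i - regFun φ θ (x i))))) ∂dataLaw φ x θ := by
        refine lintegral_mono fun Y => ?_
        rw [hz, ← ENNReal.ofReal_add (Real.exp_pos _).le (Real.exp_pos _).le,
          ← ENNReal.ofReal_mul (by norm_num)]
        refine ENNReal.ofReal_le_ofReal ?_
        simp_rw [neg_mul]
        rw [Finset.sum_neg_distrib]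
        exact pow_four_le_exp _
    _ ≤ _ := by
        rw [lintegral_const_mul _ (by fun_prop), lintegral_add_left (by fun_prop),
          lintegral_exp_sum_noise, lintegral_exp_sum_noise, ha2, ha2',
          ← ENNReal.ofReal_add (Real.exp_pos _).le (Real.exp_pos _).le,
          ← ENNReal.ofReal_mul (by norm_num)]
        exact ENNReal.ofReal_le_ofReal (by linarith)

theorem IsOrthDesign.dataLaw_noise_le (h : IsOrthDesign φ x K) (hn : n ≠ 0) (θ : ℕ → ℝ) {c : ℝ}
    (hc : 0 < c) :
    dataLaw φ x θ {Y | c ≤ ∑ j ∈ Finset.range K,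
      (n : ℝ) ^ 2 * coef φ x (fun i => Y i - regFun φ θ (x i)) j ^ 4 * ((j : ℝ) + 1)⁻¹} ≤
      ENNReal.ofReal (96 * (1 + Real.log n) / c) := by
  set S : (Fin n → ℝ) → ℝ := fun Y => ∑ j ∈ Finset.range K,
    (n : ℝ) ^ 2 * coef φ x (fun i => Y i - regFun φ θ (x i)) j ^ 4 * ((j : ℝ) + 1)⁻¹ with hS
  have hm := fun j => measurable_coef_noise (φ := φ) (x := x) θ j
  have hSm : Measurable S := by fun_prop
  have hharm : ∑ j ∈ Finset.range K, 96 * ((j : ℝ) + 1)⁻¹ ≤ 96 * (1 + Real.log n) := by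
    rw [← Finset.mul_sum]
    have h1 := harmonic_le_one_add_log n
    rw [harmonic] at h1
    push_cast at h1
    refine mul_le_mul_of_nonneg_left (le_trans ?_ h1) (by norm_num)
    -- Since `K ≤ n`, the weights sum to at most the harmonic number of `n`.
    exact Finset.sum_le_sum_of_subset_of_nonneg (Finset.range_mono (h.le hn)) fun j _ _ => by positivity
  have hint : ∫⁻ Y, ENNReal.ofReal (S Y) ∂dataLaw φ x θ ≤
      ENNReal.ofReal (96 * (1 + Real.log n)) := by
    have h1 : ∀ Y, ENNReal.ofReal (S Y) = ∑ j ∈ Finset.range K, ENNReal.ofReal ((n : ℝ) ^ 2 *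
        coef φ x (fun i => Y i - regFun φ θ (x i)) j ^ 4 * ((j : ℝ) + 1)⁻¹) := fun Y =>
      ENNReal.ofReal_sum_of_nonneg fun j _ => by positivity
    simp_rw [h1]
    rw [lintegral_finsetSum _ fun j _ => by fun_prop]
    refine le_trans ?_ (ENNReal.ofReal_le_ofReal hharm)
    rw [ENNReal.ofReal_sum_of_nonneg fun j _ => by positivity]
    refine Finset.sum_le_sum fun j hj => ?_
    rw [ENNReal.ofReal_mul (by norm_num)]
    have h2 : ∀ Y : Fin n → ℝ, ENNReal.ofReal ((n : ℝ) ^ 2 *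
        coef φ x (fun i => Y i - regFun φ θ (x i)) j ^ 4 * ((j : ℝ) + 1)⁻¹) =
        ENNReal.ofReal ((n : ℝ) ^ 2 * coef φ x (fun i => Y i - regFun φ θ (x i)) j ^ 4) *
          ENNReal.ofReal ((j : ℝ) + 1)⁻¹ := fun Y => ENNReal.ofReal_mul (by positivity)
    simp_rw [h2]
    rw [lintegral_mul_const _ (by fun_prop)]
    gcongr
    exact h.lintegral_noise_pow_four_le hn θ (Finset.mem_range.1 hj)
  have h2 := mul_meas_ge_le_lintegral (μ := dataLaw φ x θ) hSm.ennreal_ofReal (ENNReal.ofReal c)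
  have h3 : {Y | c ≤ S Y} ⊆ {Y | ENNReal.ofReal c ≤ ENNReal.ofReal (S Y)} :=
    fun Y hY => ENNReal.ofReal_le_ofReal hY
  rw [ENNReal.ofReal_div_of_pos hc]
  refine ENNReal.le_div_iff_mul_le (Or.inl (ENNReal.ofReal_pos.2 hc).ne')
    (Or.inl ENNReal.ofReal_ne_top) |>.2 ?_
  rw [mul_comm]
  exact (mul_le_mul_right (measure_mono h3) _).trans (h2.trans hint)

/-! ### Self-similar sequences -/

theorem selfSimilar.sq_le {β L : ℝ} {θ : ℕ → ℝ} (hθ : θ ∈ selfSimilar β L) (j : ℕ) :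
    θ j ^ 2 ≤ L ^ 2 * ((j : ℝ) + 1) ^ (-(1 + 2 * β)) := by
  have h := pow_le_pow_left₀ (abs_nonneg _) (hθ j).2 2
  rw [sq_abs, mul_pow, ← Real.rpow_mul_natCast (by positivity)] at h
  rwa [show (-β - 1 / 2) * ((2 : ℕ) : ℝ) = -(1 + 2 * β) by push_cast; ring] at h

theorem selfSimilar.le_sq {β L : ℝ} (hL : 0 < L) {θ : ℕ → ℝ} (hθ : θ ∈ selfSimilar β L) (j : ℕ) :
    (L ^ 2)⁻¹ * ((j : ℝ) + 1) ^ (-(1 + 2 * β)) ≤ θ j ^ 2 := by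
  have h := pow_le_pow_left₀ (by positivity) (hθ j).1 2
  rw [sq_abs, mul_pow, ← Real.rpow_mul_natCast (by positivity), inv_pow] at h
  rwa [show (-β - 1 / 2) * ((2 : ℕ) : ℝ) = -(1 + 2 * β) by push_cast; ring] at h

/-- The squared bias of the models of dimension at most `2 * κ`. -/
theorem selfSimilar.le_sum_sq {β L : ℝ} (hβ : 0 < β) (hL : 0 < L) {θ : ℕ → ℝ}
    (hθ : θ ∈ selfSimilar β L) {κ k : ℕ} (hk0 : k ≠ 0) (hk : k ≤ 2 * κ) (hK : 4 * κ ≤ K) :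
    (L ^ 2)⁻¹ * (2⁻¹ * 4 ^ (-(2 * β))) * (κ * (κ : ℝ) ^ (-(1 + 2 * β))) ≤
      ∑ j ∈ Finset.Ico k K, θ j ^ 2 := by
  have hk' : (0 : ℝ) < k := Nat.cast_pos.2 (Nat.pos_of_ne_zero hk0)
  have hκ' : (0 : ℝ) < κ := Nat.cast_pos.2 (by omega)
  calc
    _ = (L ^ 2)⁻¹ * (2⁻¹ * (4 * κ : ℝ) ^ (-(2 * β))) := by
        rw [Real.mul_rpow (by norm_num) hκ'.le, neg_add, Real.rpow_add hκ', Real.rpow_neg_one]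
        field_simp
    _ ≤ (L ^ 2)⁻¹ * (2⁻¹ * (2 * k : ℝ) ^ (-(2 * β))) := by
        refine mul_le_mul_of_nonneg_left (mul_le_mul_of_nonneg_left ?_ (by norm_num)) (by positivity)
        refine Real.rpow_le_rpow_of_nonpos (by positivity) ?_ (by linarith)
        have : (k : ℝ) ≤ 2 * κ := by exact_mod_cast hk
        linarith
    -- The block `[k, 2 * k)` alone suffices: it contains `k` coefficients of comparable size and
    -- lies below `4 * κ ≤ K`.
    _ = ∑ _j ∈ Finset.Ico k (2 * k), (L ^ 2)⁻¹ * (2 * k : ℝ) ^ (-(1 + 2 * β)) := by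
        rw [Finset.sum_const, Nat.card_Ico, nsmul_eq_mul, show 2 * k - k = k by omega, neg_add,
          Real.rpow_add (by positivity), Real.rpow_neg_one]
        field_simp
    _ ≤ ∑ j ∈ Finset.Ico k (2 * k), θ j ^ 2 := by
        refine Finset.sum_le_sum fun j hj => le_trans ?_ (selfSimilar.le_sq hL hθ j)
        refine mul_le_mul_of_nonneg_left ?_ (by positivity)
        refine Real.rpow_le_rpow_of_nonpos (by positivity) ?_ (by linarith)
        exact_mod_cast (Finset.mem_Ico.1 hj).2
    _ ≤ _ := Finset.sum_le_sum_of_subset_of_nonneg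
        (Finset.Ico_subset_Ico_right (by omega)) fun _ _ _ => sq_nonneg _

/-- The coverage of the inflated credible ball at sample size `n`, when the cutoff `κ` separates
models with too large a bias from models that are too large to be selected. -/
theorem IsOrthDesign.dataLaw_credibleSet_le (h : IsOrthDesign φ x K) (hn : n ≠ 0) {ψ : ℝ → ℝ}
    (hψ : ConvexOn ℝ Set.univ ψ) {G : ℝ} (hG : ∀ t, Real.exp (-ψ t) ≤ G) {β L B α : ℝ}
    (hβ : 1 / 2 < β) (hL : 0 < L) (hα : α ∈ Set.Ioo (0 : ℝ) 1) (hφ : ∀ j t, |φ j t| ≤ B)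
    {θ : ℕ → ℝ} (hθ : θ ∈ selfSimilar β L) {Kbar : ℕ} (hKbar : Kbar ≤ K)
    {khat : (Fin n → ℝ) → ℕ} (hkhat : IsMMLE φ (expMeasure ψ) x Kbar khat) {κ : ℕ} (hκ0 : κ ≠ 0)
    (hκK : 4 * κ ≤ K) {c T m : ℝ}
    (hlog0 : 0 < Real.log n) (hlog : 2 * Real.log (G * Real.sqrt (2 * Real.pi)) ≤ Real.log n / 4)
    (hup : 36 * L ^ 2 * n ≤ (κ : ℝ) ^ (1 + 2 * β) * Real.log n)
    (hlow : c * ((κ : ℝ) ^ (1 + 2 * β) * Real.log n) ≤ (L ^ 2)⁻¹ * (2⁻¹ * 4 ^ (-(2 * β))) * n)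
    (hT : ∀ t, |tailFun φ θ K t| ≤ T)
    (hT1 : n * T ^ 2 ≤ κ * Real.log n / 36) (hT2 : n * T ^ 2 ≤ c / 8 * (κ * Real.log n))
    (hm : 8 * m ^ 2 < c * α) :
    dataLaw φ x θ {Y | θ ∈ credibleSet φ (expMeasure ψ) x α (m * Real.sqrt (Real.log n)) Y
      (khat Y)} ≤ ENNReal.ofReal (96 * (1 + Real.log n) / (Real.log n ^ 2 / 72)) := by
  have hn' : (0 : ℝ) < n := Nat.cast_pos.2 (Nat.pos_of_ne_zero hn)
  have hκ' : (0 : ℝ) < κ := Nat.cast_pos.2 (Nat.pos_of_ne_zero hκ0)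
  have hp : 0 < (κ : ℝ) ^ (1 + 2 * β) := by positivity
  have hα0 := hα.1
  have hs := fun t => selfSimilar.summable hβ hφ hθ t
  -- The coverage event is included pointwise in the large-noise event. Only monotonicity is used,
  -- so `khat` need not be measurable.
  refine le_trans (measure_mono fun Y hY => ?_) (h.dataLaw_noise_le hn θ (by positivity))
  obtain ⟨hk, hmax⟩ := hkhat Y
  obtain ⟨hk1, hk2⟩ := Finset.mem_Icc.1 hk
  set k := khat Y with hkdef
  rcases le_or_gt k (2 * κ) with hk3 | hk3
  -- Small models never cover: with `A = κ * log n`, the bias is at least `c * A`, whereas coverage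
  -- would bound it by `2 * (c / 4) * A + 2 * (c / 8) * A`.
  · exfalso
    have hk0 : k ≠ 0 := by omega
    have hkκ : (k : ℝ) ≤ 2 * κ := by exact_mod_cast hk3
    have h1 := selfSimilar.le_sum_sq (by linarith) hL hθ hk0 hk3 hκK
    have h2 := h.sum_sq_le_empDist hn (hk2.trans hKbar) hs hT
      (posteriorMean φ (expMeasure ψ) x Y k)
    have hr0 := credibleRadius_nonneg (φ := φ) (x := x) (g := expMeasure ψ) hα.2 Y k
    have hr := h.credibleRadius_le hn (hk2.trans hKbar) hk0 hψ hG hα Y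
    have hr2 : credibleRadius φ (expMeasure ψ) x α Y k ^ 2 ≤ k / (n * α) :=
      (Real.le_sqrt hr0 (by positivity)).1 hr
    have h3 : empDist φ x θ (padZero (posteriorMean φ (expMeasure ψ) x Y k)) ≤
      m * Real.sqrt (Real.log n) * credibleRadius φ (expMeasure ψ) x α Y k := hY
    have h4 := pow_le_pow_left₀ (empDist_nonneg _ _) h3 2
    rw [mul_pow, mul_pow, Real.sq_sqrt hlog0.le] at h4
    have h5 : n * empDist φ x θ (padZero (posteriorMean φ (expMeasure ψ) x Y k)) ^ 2 ≤
        c / 4 * (κ * Real.log n) := by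
      calc
        _ ≤ n * (m ^ 2 * Real.log n * (k / (n * α))) := by
            refine mul_le_mul_of_nonneg_left (h4.trans ?_) hn'.le
            gcongr
        _ = m ^ 2 * Real.log n * k / α := by field_simp
        _ ≤ m ^ 2 * Real.log n * (2 * κ) / α := by gcongr
        _ ≤ c / 4 * (κ * Real.log n) := by
            rw [div_le_iff₀ hα0]
            have : 0 < κ * Real.log n := by positivity
            nlinarith
    have h6 : c * (κ * Real.log n) ≤ n * ∑ j ∈ Finset.Ico k K, θ j ^ 2 := by
      calc
        _ = κ * (κ : ℝ) ^ (-(1 + 2 * β)) * (c * ((κ : ℝ) ^ (1 + 2 * β) * Real.log n)) := by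
            rw [Real.rpow_neg hκ'.le]; field_simp
        _ ≤ κ * (κ : ℝ) ^ (-(1 + 2 * β)) * ((L ^ 2)⁻¹ * (2⁻¹ * 4 ^ (-(2 * β))) * n) := by gcongr
        _ = n * ((L ^ 2)⁻¹ * (2⁻¹ * 4 ^ (-(2 * β))) * (κ * (κ : ℝ) ^ (-(1 + 2 * β)))) := by ring
        _ ≤ _ := by gcongr
    have hc : 0 < c := pos_of_mul_pos_left (lt_of_le_of_lt (by positivity) hm) hα0.le
    have h7 : 0 < c * (κ * Real.log n) := by positivity
    have h8 := mul_le_mul_of_nonneg_left h2 hn'.le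
    linarith
  -- Large models: `κ < k ≤ Kbar`, so `κ` is itself a candidate and the selected `k` must beat it.
  · refine h.le_sum_noise hn hψ hG hk3 (hk2.trans hKbar) (hmax κ ?_) hs hT hlog (fun j hj => ?_) hT1
    · exact Finset.mem_Icc.2 ⟨Nat.one_le_iff_ne_zero.2 hκ0, by omega⟩
    · calc
        n * θ j ^ 2 ≤ n * (L ^ 2 * (κ : ℝ) ^ (-(1 + 2 * β))) := by
            gcongr
            refine (selfSimilar.sq_le hθ j).trans (mul_le_mul_of_nonneg_left ?_ (sq_nonneg _))
            refine Real.rpow_le_rpow_of_nonpos hκ' ?_ (by linarith)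
            have : (κ : ℝ) ≤ j := by exact_mod_cast hj
            linarith
        _ = 36 * L ^ 2 * n * (κ : ℝ) ^ (-(1 + 2 * β)) / 36 := by ring
        _ ≤ (κ : ℝ) ^ (1 + 2 * β) * Real.log n * (κ : ℝ) ^ (-(1 + 2 * β)) / 36 := by gcongr
        _ = Real.log n / 36 := by rw [Real.rpow_neg hκ'.le]; field_simp

/-! ### The critical dimension -/

/-- The critical dimension `(M n / log n) ^ (1 / (1 + 2 β))`, rounded up. -/
noncomputable def cutoff (β M : ℝ) (n : ℕ) : ℕ :=
  ⌈(M * (n / Real.log n)) ^ (1 / (1 + 2 * β))⌉₊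

theorem tendsto_log_natCast : Tendsto (fun n : ℕ => Real.log n) atTop atTop :=
  Real.tendsto_log_atTop.comp tendsto_natCast_atTop_atTop

theorem tendsto_natCast_div_log : Tendsto (fun n : ℕ => (n : ℝ) / Real.log n) atTop atTop := by
  have h1 : Tendsto (fun y : ℝ => Real.log y / y) atTop (𝓝 0) :=
    Real.isLittleO_log_id_atTop.tendsto_div_nhds_zero
  have h2 : Tendsto (fun y : ℝ => Real.log y / y) atTop (𝓝[>] 0) := by
    refine tendsto_nhdsWithin_iff.2 ⟨h1, ?_⟩
    filter_upwards [eventually_gt_atTop 1] with y hy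
    exact div_pos (Real.log_pos hy) (by linarith)
  have h3 := (tendsto_inv_nhdsGT_zero.comp h2).comp (tendsto_natCast_atTop_atTop (R := ℝ))
  simpa [Function.comp_def] using h3

theorem cutoff_bounds {β M : ℝ} (hβ : 0 < β) (hM : 0 < M) :
    ∀ᶠ n : ℕ in atTop, cutoff β M n ≠ 0 ∧
      (M * (n / Real.log n)) ^ (1 / (1 + 2 * β)) ≤ cutoff β M n ∧
      (cutoff β M n : ℝ) ≤ 2 * (M * (n / Real.log n)) ^ (1 / (1 + 2 * β)) := by
  have h1 := (tendsto_rpow_atTop (y := 1 / (1 + 2 * β)) (by positivity)).comp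
    (tendsto_natCast_div_log.const_mul_atTop hM)
  filter_upwards [h1.eventually_ge_atTop 1] with n hn
  simp only [Function.comp_apply] at hn
  refine ⟨(Nat.ceil_pos.2 (zero_lt_one.trans_le hn)).ne', Nat.le_ceil _, ?_⟩
  have := (Nat.ceil_lt_add_one (zero_le_one.trans hn)).le
  rw [cutoff]
  linarith

theorem cutoff_rpow_bounds {β M : ℝ} (hβ : 0 < β) (hM : 0 < M) :
    ∀ᶠ n : ℕ in atTop, M * n ≤ (cutoff β M n : ℝ) ^ (1 + 2 * β) * Real.log n ∧
      (cutoff β M n : ℝ) ^ (1 + 2 * β) * Real.log n ≤ 2 ^ (1 + 2 * β) * (M * n) := by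
  filter_upwards [cutoff_bounds hβ hM, tendsto_log_natCast.eventually_gt_atTop 0]
    with n ⟨_, h1, h2⟩ hlog
  have hp : 0 < 1 + 2 * β := by linarith
  have hu : ((M * (n / Real.log n)) ^ (1 / (1 + 2 * β))) ^ (1 + 2 * β) * Real.log n = M * n := by
    rw [← Real.rpow_mul (by positivity), one_div_mul_cancel hp.ne', Real.rpow_one]
    field_simp
  constructor
  · rw [← hu]
    gcongr
  · have h3 : (cutoff β M n : ℝ) ^ (1 + 2 * β) ≤
        (2 * (M * (n / Real.log n)) ^ (1 / (1 + 2 * β))) ^ (1 + 2 * β) := by gcongr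
    rw [Real.mul_rpow (by norm_num) (by positivity)] at h3
    have h4 := mul_le_mul_of_nonneg_right h3 hlog.le
    rwa [mul_assoc, hu] at h4

theorem rpow_div_log (β M : ℝ) (hM : 0 < M) {n : ℕ} (hlog : 0 < Real.log n) :
    (M * (n / Real.log n)) ^ (1 / (1 + 2 * β)) =
      M ^ (1 / (1 + 2 * β)) * (n : ℝ) ^ (1 / (1 + 2 * β)) * (Real.log n ^ (1 / (1 + 2 * β)))⁻¹ := by
  rw [Real.mul_rpow hM.le (by positivity), Real.div_rpow (by positivity) hlog.le]
  ring

/-- The exponent of `K_n` is at least `1 / (1 + 2 * β)`, and the logarithm in the denominator of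
`cutoff` absorbs the constants. -/
theorem four_mul_cutoff_le {β₀ β M : ℝ} (hβ₀ : 1 / 2 < β₀) (hβ : β₀ ≤ β) (hM : 0 < M) :
    ∀ᶠ n : ℕ in atTop, ((4 * cutoff β M n : ℕ) : ℝ) ≤
      (n : ℝ) ^ (β₀ / ((1 + 2 * β₀) * (β₀ - 1 / 2))) := by
  have hρ : 0 < 1 / (1 + 2 * β) := by have : 0 < 1 + 2 * β := by linarith
                                      positivity
  filter_upwards [cutoff_bounds (β := β) (by linarith) hM, tendsto_log_natCast.eventually_gt_atTop 0,
    ((tendsto_rpow_atTop hρ).comp tendsto_log_natCast).eventually_ge_atTop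
      (8 * M ^ (1 / (1 + 2 * β))), eventually_ge_atTop 1] with n ⟨_, _, h1⟩ hlog h2 hn
  simp only [Function.comp_apply] at h2
  have hn' : (1 : ℝ) ≤ n := by exact_mod_cast hn
  rw [rpow_div_log β M hM hlog] at h1
  have hl : 0 < Real.log n ^ (1 / (1 + 2 * β)) := by positivity
  calc
    ((4 * cutoff β M n : ℕ) : ℝ) ≤ 8 * M ^ (1 / (1 + 2 * β)) * (n : ℝ) ^ (1 / (1 + 2 * β)) *
        (Real.log n ^ (1 / (1 + 2 * β)))⁻¹ := by push_cast; linarith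
    _ ≤ Real.log n ^ (1 / (1 + 2 * β)) * (n : ℝ) ^ (1 / (1 + 2 * β)) *
        (Real.log n ^ (1 / (1 + 2 * β)))⁻¹ := by gcongr
    _ = (n : ℝ) ^ (1 / (1 + 2 * β)) := by field_simp
    _ ≤ _ := by
        refine Real.rpow_le_rpow_of_exponent_le hn' ?_
        rw [div_le_div_iff₀ (by linarith) (mul_pos (by linarith) (by linarith))]
        nlinarith [mul_nonneg (show 0 ≤ β₀ by linarith) (sub_nonneg.2 hβ)]

/-- The exponent of `K_n` is exactly what makes the powers of `n` balance at `β = β₀`; for larger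
`β` it is more than enough. The arbitrarily small `δ` is paid for by the factor `(log n) ^ (1 - 1 /
(1 + 2 * β))` left in `κ * log n`. -/
theorem natCast_mul_rpow_sq_le_cutoff {β₀ β M : ℝ} (hβ₀ : 1 / 2 < β₀) (hβ : β₀ ≤ β) (hM : 0 < M)
    {δ : ℝ} (hδ : 0 < δ) :
    ∀ᶠ n : ℕ in atTop, ∀ K : ℕ, (n : ℝ) ^ (β₀ / ((1 + 2 * β₀) * (β₀ - 1 / 2))) < K →
      n * ((K : ℝ) ^ (-(β - 1 / 2))) ^ 2 ≤ δ * (cutoff β M n * Real.log n) := by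
  have hp : 0 < 1 + 2 * β := by linarith
  have hρ : 0 < 1 - 1 / (1 + 2 * β) := by
    rw [sub_pos, div_lt_one hp]; linarith
  filter_upwards [cutoff_bounds (β := β) (by linarith) hM, tendsto_log_natCast.eventually_gt_atTop 0,
    (((tendsto_rpow_atTop hρ).comp tendsto_log_natCast).const_mul_atTop
      (show 0 < δ * M ^ (1 / (1 + 2 * β)) by positivity)).eventually_ge_atTop 1,
    eventually_ge_atTop 1] with n ⟨_, h1, _⟩ hlog h2 hn K hK
  simp only [Function.comp_apply] at h2
  have hn' : (1 : ℝ) ≤ n := by exact_mod_cast hn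
  have hn0 : (0 : ℝ) < n := by linarith
  rw [rpow_div_log β M hM hlog] at h1
  set e := β₀ / ((1 + 2 * β₀) * (β₀ - 1 / 2)) with he
  have hexp : 1 + e * (-(2 * β - 1)) ≤ 1 / (1 + 2 * β) := by
    have h3 : 1 - 1 / (1 + 2 * β) = 2 * β / (1 + 2 * β) := by field_simp; ring
    have h4 : 2 * β / (1 + 2 * β) ≤ e * (2 * β - 1) := by
      rw [he, div_mul_eq_mul_div, div_le_div_iff₀ hp (mul_pos (by linarith) (by linarith))]
      -- This product is the difference of the two sides after clearing denominators.
      have : 0 ≤ (4 * β * β₀ + 1) * (β - β₀) :=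
        mul_nonneg (by nlinarith) (sub_nonneg.2 hβ)
      nlinarith
    linarith
  calc
    n * ((K : ℝ) ^ (-(β - 1 / 2))) ^ 2 = n * (K : ℝ) ^ (-(2 * β - 1)) := by
        rw [← Real.rpow_mul_natCast (by positivity)]
        congr 2
        push_cast; ring
    _ ≤ n * ((n : ℝ) ^ e) ^ (-(2 * β - 1)) := by
        refine mul_le_mul_of_nonneg_left ?_ hn0.le
        exact Real.rpow_le_rpow_of_nonpos (by positivity) hK.le (by linarith)
    _ = (n : ℝ) ^ (1 + e * (-(2 * β - 1))) := by
        rw [← Real.rpow_mul hn0.le, Real.rpow_add hn0, Real.rpow_one]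
    _ ≤ 1 * (n : ℝ) ^ (1 / (1 + 2 * β)) := by
        rw [one_mul]
        exact Real.rpow_le_rpow_of_exponent_le hn' hexp
    _ ≤ δ * M ^ (1 / (1 + 2 * β)) * Real.log n ^ (1 - 1 / (1 + 2 * β)) *
        (n : ℝ) ^ (1 / (1 + 2 * β)) := by gcongr
    _ = δ * (M ^ (1 / (1 + 2 * β)) * (n : ℝ) ^ (1 / (1 + 2 * β)) *
        (Real.log n ^ (1 / (1 + 2 * β)))⁻¹ * Real.log n) := by
        rw [Real.rpow_sub hlog, Real.rpow_one]
        ring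
    _ ≤ _ := by gcongr

theorem tendsto_noise_bound :
    Tendsto (fun n : ℕ => ENNReal.ofReal (96 * (1 + Real.log n) / (Real.log n ^ 2 / 72))) atTop
      (𝓝 0) := by
  have h1 : Tendsto (fun y : ℝ => 96 * 72 * ((y⁻¹) ^ 2 + y⁻¹)) atTop (𝓝 (96 * 72 * (0 ^ 2 + 0))) :=
    ((tendsto_inv_atTop_zero.pow 2).add tendsto_inv_atTop_zero).const_mul _
  have h2 : Tendsto (fun n : ℕ => 96 * (1 + Real.log n) / (Real.log n ^ 2 / 72)) atTop (𝓝 0) := by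
    have h3 := h1.comp tendsto_log_natCast
    norm_num only [] at h3
    refine h3.congr' ?_
    filter_upwards [tendsto_log_natCast.eventually_gt_atTop 0] with n hn
    simp only [Function.comp_apply]
    field_simp
    ring
  simpa using ENNReal.tendsto_ofReal h2

end SieveRegression

/-! ### Choice of constants and conclusion -/

open SieveRegression in
theorem mainTheorem7
    (β₀ β L α B : ℝ) (hβ₀ : 1 / 2 < β₀) (hβ : β₀ ≤ β) (hL : 0 < L) (hα : α ∈ Set.Ioo (0 : ℝ) 1)
    (φ : ℕ → unitInterval → ℝ) (hφ : ∀ j t, |φ j t| ≤ B)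
    (x : (n : ℕ) → Fin n → unitInterval)
    (K Kbar : ℕ → ℕ)
    (hK : ∀ᶠ n : ℕ in atTop, (n : ℝ) ^ (β₀ / ((1 + 2 * β₀) * (β₀ - 1 / 2))) < (K n : ℝ))
    (horth : ∀ᶠ n : ℕ in atTop, ∀ k ≤ K n,
      (SieveRegression.designMatrix φ (x n) k).transpose *
        SieveRegression.designMatrix φ (x n) k = (n : ℝ) • (1 : Matrix (Fin k) (Fin k) ℝ))
    (hKbar : ∀ᶠ n : ℕ in atTop, 1 ≤ Kbar n ∧ Kbar n ≤ K n)
    (g : Measure ℝ) (hg : SieveRegression.IsNormalOrLaplace g)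
    (khat : (n : ℕ) → (Fin n → ℝ) → ℕ)
    (hkhat : ∀ᶠ n : ℕ in atTop, SieveRegression.IsMMLE φ g (x n) (Kbar n) (khat n))
    (m : ℕ → ℝ) (hm : Tendsto m atTop (𝓝 0)) :
    limsup (fun n : ℕ => ⨆ θ₀ ∈ SieveRegression.selfSimilar β L,
      SieveRegression.dataLaw φ (x n) θ₀
        {Y | θ₀ ∈ SieveRegression.credibleSet φ g (x n) α (m n * Real.sqrt (Real.log n)) Y
          (khat n Y)}) atTop = 0 := by
  obtain ⟨ψ, G, hψ, hG, rfl⟩ := hg.exists_potential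
  have hβ' : 1 / 2 < β := hβ₀.trans_le hβ
  have hM : 0 < 36 * L ^ 2 := by positivity
  set C := L * B * (β - 1 / 2)⁻¹
  -- The bias constant of `selfSimilar.le_sum_sq` divided by the upper constant of
  -- `cutoff_rpow_bounds` at `M = 36 * L ^ 2`.
  set c := (L ^ 2)⁻¹ * (2⁻¹ * 4 ^ (-(2 * β))) / (2 ^ (1 + 2 * β) * (36 * L ^ 2)) with hc
  have hc0 : 0 < c := by positivity
  -- Small enough for both requirements on the tail, in the overfitting and in the bias argument;
  -- the `+ 1` avoids a division by zero.
  set δ := min (1 / 36) (c / 8) / (C ^ 2 + 1) with hδ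
  have hδ0 : 0 < δ := by positivity
  have hCδ : C ^ 2 * δ ≤ min (1 / 36) (c / 8) := by
    rw [hδ, mul_div_assoc', div_le_iff₀ (by positivity), mul_comm]
    gcongr
    linarith
  have hm2 : ∀ᶠ n in atTop, 8 * m n ^ 2 < c * α := by
    have h1 : Tendsto (fun n => 8 * m n ^ 2) atTop (𝓝 (8 * 0 ^ 2)) := (hm.pow 2).const_mul 8
    refine h1.eventually_lt_const ?_
    have := hα.1
    simpa using mul_pos hc0 this
  refine Tendsto.limsup_eq (tendsto_of_tendsto_of_tendsto_of_le_of_le' tendsto_const_nhds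
    tendsto_noise_bound (Eventually.of_forall fun _ => bot_le) ?_)
  filter_upwards [hK, horth, hKbar, hkhat, hm2, eventually_ge_atTop 1,
    tendsto_log_natCast.eventually_gt_atTop 0,
    tendsto_log_natCast.eventually_ge_atTop (4 * (2 * Real.log (G * Real.sqrt (2 * Real.pi)))),
    cutoff_bounds (β := β) (by linarith) hM, cutoff_rpow_bounds (β := β) (by linarith) hM,
    four_mul_cutoff_le hβ₀ hβ hM, natCast_mul_rpow_sq_le_cutoff hβ₀ hβ hM hδ0]
    with n hKn horthn hKbarn hkhatn hmn hn1 hlog0 hlog hcut hcutp h4 htail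
  have hn : n ≠ 0 := by omega
  have hn' : (0 : ℝ) < n := Nat.cast_pos.2 (Nat.pos_of_ne_zero hn)
  have hK0 : K n ≠ 0 := by
    rintro h0
    rw [h0, Nat.cast_zero] at hKn
    exact hKn.not_ge (by positivity)
  set κ := cutoff β (36 * L ^ 2) n
  have hκlog : 0 ≤ κ * Real.log n := by positivity
  have hT : n * (C * (K n : ℝ) ^ (-(β - 1 / 2))) ^ 2 ≤
      min (1 / 36) (c / 8) * (κ * Real.log n) := by
    have h1 := mul_le_mul_of_nonneg_left (htail (K n) hKn) (sq_nonneg C)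
    have h2 := mul_le_mul_of_nonneg_right hCδ hκlog
    calc
      _ = C ^ 2 * (n * ((K n : ℝ) ^ (-(β - 1 / 2))) ^ 2) := by ring
      _ ≤ C ^ 2 * (δ * (κ * Real.log n)) := h1
      _ = C ^ 2 * δ * (κ * Real.log n) := by ring
      _ ≤ _ := h2
  refine iSup₂_le fun θ hθ => ?_
  refine (isOrthDesign_of_designMatrix (horthn _ le_rfl)).dataLaw_credibleSet_le hn hψ hG hβ' hL hα
    hφ hθ hKbarn.2 hkhatn hcut.1 (by exact_mod_cast (h4.trans_lt hKn).le) (c := c) hlog0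
    (by linarith) hcutp.1 ?_ (selfSimilar.abs_tailFun_le hβ' hL hφ hθ hK0) ?_ ?_ hmn
  · refine (mul_le_mul_of_nonneg_left hcutp.2 hc0.le).trans_eq ?_
    rw [hc]
    field_simp
  · have := mul_le_mul_of_nonneg_right (min_le_left (1 / 36 : ℝ) (c / 8)) hκlog
    linarith
  · exact hT.trans (mul_le_mul_of_nonneg_right (min_le_right _ _) hκlog)
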